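/- Let $X$ be a smooth projective variety over $\mathbb{C}$ and let $E$ be a vector bundle on $X$, i.e. a locally free sheaf of finite rank. For a vector bundle $F$ on $X$ let $\mathrm{Bs}(F)$ be the set of points $x\in X$ at which the evaluation map $H^0(X,F)\otimes_{\mathbb{C}}\kappa(x)\to F(x)=F\otimes\kappa(x)$ is not surjective, and let $$\mathbb{B}(F)=\bigcap_{m>0}\mathrm{Bs}(\mathrm{Sym}^m F).$$ For an ample line bundle $H$ on $X$ put $$\mathbb{B}_+^{H}(F)=\bigcap_{p,q>0}\mathbb{B}\big(\mathrm{Sym}^q F\otimes H^{-p}\big),\qquad \mathbb{B}_-^{H}(F)=\bigcup_{p,q>0}\mathbb{B}\big(\mathrm{Sym}^q F\otimes H^{p}\big),$$ where $p,q$ run over the positive integers (the augmented and the restricted base locus of $F$). Say that $F$ is pseudo-effective (with respect to $H$) if $\mathbb{B}_-^{H}(F)\neq X$, and weakly positive (with respect to $H$) if $\overline{\mathbb{B}_-^{H}(F)}\neq X$. Say that $E$ is V-big (with respect to $H$) if there are an ample line bundle $A$ and an integer $c>0$ such that $\mathrm{Sym}^c E\otimes A^{-1}$ is weakly positive with respect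 to $H$. Then, for any ample line bundles $H_1,H_2,H_3$ on $X$, the following are equivalent: 1. $E$ is V-big with respect to $H_1$; 2. there are an ample line bundle $A$ on $X$ and an integer $c>0$ such that $\mathrm{Sym}^c E\otimes A^{-1}$ is pseudo-effective with respect to $H_2$; 3. $\mathbb{B}_+^{H_3}(E)\neq X$. (In particular none of the three conditions depends on the auxiliary ample line bundle.) -/

import Mathlib

open CategoryTheory AlgebraicGeometry TopologicalSpace Opposite
open scoped TensorProduct

noncomputable section

/-! ### Functoriality of symmetric powers along semilinear maps -/

namespace SymPow

/-- The additive map `Sym^n_R M → Sym^n_S N`, `m₁ ⋯ mₙ ↦ φ(m₁) ⋯ φ(mₙ)`, attached to a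
`σ`-semilinear map `φ : M → N`. -/
def map {R S M N : Type} [CommRing R] [CommRing S] [AddCommGroup M] [AddCommGroup N]
    [Module R M] [Module S N] (σ : R →+* S) (φ : M →ₛₗ[σ] N) (n : ℕ) :
    SymmetricPower R (Fin n) M →+ SymmetricPower S (Fin n) N :=
  letI : Module R (SymmetricPower S (Fin n) N) := Module.compHom _ σ
  let μ : MultilinearMap R (fun _ : Fin n => M) (SymmetricPower S (Fin n) N) :=
    { toFun := fun m => SymmetricPower.tprod S (fun i => φ (m i))
      map_update_add' := by
        intro inst m i x y
        obtain rfl : inst = instDecidableEqFin n := Subsingleton.elim _ _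
        have key : ∀ z, (fun j => φ (Function.update m i z j)) =
            Function.update (fun j => φ (m j)) i (φ z) := by
          intro z; ext j; by_cases h : j = i
          · subst h; simp
          · simp [h]
        rw [key, key, key, map_add, MultilinearMap.map_update_add]
      map_update_smul' := by
        intro inst m i c x
        obtain rfl : inst = instDecidableEqFin n := Subsingleton.elim _ _
        have key : ∀ z, (fun j => φ (Function.update m i z j)) =
            Function.update (fun j => φ (m j)) i (φ z) := by
          intro z; ext j; by_cases h : j = i
          · subst h; simp
          · simp [h]
        rw [key, key, map_smulₛₗ, MultilinearMap.map_update_smul]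
        rfl }
  AddCon.lift _ (PiTensorProduct.lift μ).toAddMonoidHom (by
    refine AddCon.addConGen_le.mpr ?_
    rintro _ _ ⟨e, f⟩
    refine (AddCon.ker_rel _).mpr ?_
    rw [LinearMap.toAddMonoidHom_coe, PiTensorProduct.lift.tprod, PiTensorProduct.lift.tprod]
    exact (SymmetricPower.tprod_equiv e (fun i => φ (f i))).symm)

section

variable {R S T M N P : Type} [CommRing R] [CommRing S] [CommRing T]
  [AddCommGroup M] [AddCommGroup N] [AddCommGroup P] [Module R M] [Module S N] [Module T P]

theorem map_tprod (σ : R →+* S) (φ : M →ₛₗ[σ] N) (n : ℕ) (m : Fin n → M) :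
    map σ φ n (SymmetricPower.tprod R m) = SymmetricPower.tprod S (fun i => φ (m i)) := by
  let : Module R (SymmetricPower S (Fin n) N) := Module.compHom _ σ
  exact PiTensorProduct.lift.tprod (R := R) (s := fun _ : Fin n => M) m

theorem map_smul (σ : R →+* S) (φ : M →ₛₗ[σ] N) (n : ℕ) (r : R)
    (x : SymmetricPower R (Fin n) M) : map σ φ n (r • x) = σ r • map σ φ n x := by
  let : Module R (SymmetricPower S (Fin n) N) := Module.compHom _ σ
  induction x using AddCon.induction_on with
  | H x => exact (PiTensorProduct.lift (R := R) (s := fun _ : Fin n => M) _).map_smul r x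

theorem hom_ext {A : Type} [AddCommGroup A] [Module R A] {n : ℕ}
    {f g : SymmetricPower R (Fin n) M → A}
    (hf : ∀ x y, f (x + y) = f x + f y) (hg : ∀ x y, g (x + y) = g x + g y)
    (hf' : ∀ (r : R) x, f (r • x) = r • f x) (hg' : ∀ (r : R) x, g (r • x) = r • g x)
    (h : ∀ m, f (SymmetricPower.tprod R m) = g (SymmetricPower.tprod R m)) : f = g := by
  have : (⟨⟨f, hf⟩, hf'⟩ : SymmetricPower R (Fin n) M →ₗ[R] A) = ⟨⟨g, hg⟩, hg'⟩ := by
    refine LinearMap.ext_on_range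
      (v := fun m : Fin n → M => SymmetricPower.tprod R m) (SymmetricPower.span_tprod_eq_top R (Fin n) M) ?_
    exact h
  exact congrArg (fun l : SymmetricPower R (Fin n) M →ₗ[R] A => (l : _ → A)) this

theorem map_id (σ : R →+* R) (hσ : σ = RingHom.id R) (φ : M →ₛₗ[σ] M) (hφ : ∀ m, φ m = m)
    (n : ℕ) (x : SymmetricPower R (Fin n) M) : map σ φ n x = x := by
  subst hσ
  refine congrFun (hom_ext (R := R) (f := fun x => map _ φ n x) (g := fun x => x) (map_add _)
    (fun _ _ => rfl) (fun r x => map_smul _ φ n r x) (fun _ _ => rfl) fun m => ?_) x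
  simp only [map_tprod, hφ]

theorem map_comp (σ : R →+* S) (τ : S →+* T) (ρ : R →+* T) (hρ : ρ = τ.comp σ)
    (φ : M →ₛₗ[σ] N) (ψ : N →ₛₗ[τ] P) (χ : M →ₛₗ[ρ] P) (hχ : ∀ m, χ m = ψ (φ m))
    (n : ℕ) (x : SymmetricPower R (Fin n) M) :
    map ρ χ n x = map τ ψ n (map σ φ n x) := by
  subst hρ
  let : Module R (SymmetricPower T (Fin n) P) := Module.compHom _ (τ.comp σ)
  refine congrFun (hom_ext (R := R) (f := fun x => map _ χ n x)
    (g := fun x => map τ ψ n (map σ φ n x)) (map_add _)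
    (fun _ _ => by simp only [map_add]) (fun r x => map_smul _ χ n r x)
    (fun r x => by simp only [map_smul]; rfl) fun m => ?_) x
  simp only [map_tprod, hχ]

end

end SymPow

namespace VB

variable {X : Scheme.{0}}

/-! ### Operations on sheaves of modules -/

/-- The sheaf associated with a presheaf of `𝒪_X`-modules. -/
def sheafify (P : X.PresheafOfModules) : X.Modules :=
  (PresheafOfModules.sheafification (𝟙 X.ringCatSheaf.obj)).obj P

/-- The structure sheaf as a module over itself. -/
def structureSheaf (X : Scheme.{0}) : X.Modules := SheafOfModules.unit X.ringCatSheaf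

/-- `M ⊗ N`, the sheaf associated with `U ↦ M(U) ⊗_{𝒪(U)} N(U)`. -/
def tensor (M N : X.Modules) : X.Modules :=
  sheafify (PresheafOfModules.Monoidal.tensorObj (R := X.presheaf) M.val N.val)

/-- The tensor power `M^{⊗ n}`. -/
def tensorPow (M : X.Modules) : ℕ → X.Modules
  | 0 => structureSheaf X
  | n + 1 => tensor (tensorPow M n) M

instance secModule (M : X.Modules) (U : X.Opensᵒᵖ) :
    Module (X.presheaf.obj U) (M.presheaf.obj U) := (M.val.obj U).isModule

/-- The restriction maps of a sheaf of modules, as semilinear maps. -/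
def res (M : X.Modules) {U V : X.Opensᵒᵖ} (i : U ⟶ V) :
    M.presheaf.obj U →ₛₗ[(X.presheaf.map i).hom] M.presheaf.obj V where
  toFun := M.presheaf.map i
  map_add' := map_add (M.presheaf.map i).hom
  map_smul' r m := Scheme.Modules.map_smul M i.unop r m

/-- The presheaf `U ↦ Sym^n_{𝒪(U)} M(U)` of abelian groups. -/
def symPresheafAb (M : X.Modules) (n : ℕ) : X.Opensᵒᵖ ⥤ Ab.{0} where
  obj U := AddCommGrpCat.of (SymmetricPower (X.presheaf.obj U) (Fin n) (M.presheaf.obj U))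
  map i := AddCommGrpCat.ofHom (SymPow.map (X.presheaf.map i).hom (res M i) n)
  map_id U := by
    ext x
    refine SymPow.map_id (X.presheaf.map (𝟙 U)).hom ?_ (res M (𝟙 U)) ?_ n x
    · rw [X.presheaf.map_id]; rfl
    · intro m; change M.presheaf.map (𝟙 U) m = m; rw [M.presheaf.map_id]; rfl
  map_comp {U V W} i j := by
    ext x
    refine SymPow.map_comp (X.presheaf.map i).hom (X.presheaf.map j).hom
      (X.presheaf.map (i ≫ j)).hom ?_ (res M i) (res M j) (res M (i ≫ j)) ?_ n x
    · rw [X.presheaf.map_comp]; rfl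
    · intro m
      change M.presheaf.map (i ≫ j) m = M.presheaf.map j (M.presheaf.map i m)
      rw [M.presheaf.map_comp]; rfl

instance (M : X.Modules) (n : ℕ) (U : X.Opensᵒᵖ) :
    Module (X.ringCatSheaf.obj.obj U) ((symPresheafAb M n).obj U) :=
  inferInstanceAs (Module (X.presheaf.obj U)
    (SymmetricPower (X.presheaf.obj U) (Fin n) (M.presheaf.obj U)))

/-- `Sym^n M`, the sheaf associated with `U ↦ Sym^n_{𝒪(U)} M(U)`. -/
def sym (n : ℕ) (M : X.Modules) : X.Modules :=
  sheafify (PresheafOfModules.ofPresheaf (symPresheafAb M n)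
    (fun _ _ i r m => SymPow.map_smul (X.presheaf.map i).hom (res M i) n r m))

/-- `Hom_{𝒪_U}(M|_U, 𝒪_U)`: families of `𝒪(V)`-linear maps `M(V) → 𝒪(V)`, for `V ⊆ U` open,
which commute with restriction. -/
def dualSections (M : X.Modules) (U : X.Opens) :
    AddSubgroup (∀ V : {V : X.Opens // V ≤ U}, (Γ(M, V.1) →ₗ[Γ(X, V.1)] Γ(X, V.1))) where
  carrier := { φ | ∀ (V W : X.Opens) (hV : V ≤ U) (hWV : W ≤ V) (m : Γ(M, V)),
    φ ⟨W, hWV.trans hV⟩ (M.presheaf.map (homOfLE hWV).op m) =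
      X.presheaf.map (homOfLE hWV).op (φ ⟨V, hV⟩ m) }
  add_mem' ha hb V W hV hWV m := by
    simp only [Pi.add_apply, LinearMap.add_apply, map_add, ha V W hV hWV m, hb V W hV hWV m]
  zero_mem' V W hV hWV m := by simp
  neg_mem' ha V W hV hWV m := by
    simp only [Pi.neg_apply, LinearMap.neg_apply, map_neg, ha V W hV hWV m]

/-- Restriction of functions from `U` to a smaller open set. -/
def resFun {U : X.Opens} (V : {V : X.Opens // V ≤ U}) : Γ(X, U) →+* Γ(X, V.1) :=
  (X.presheaf.map (homOfLE V.2).op).hom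

instance (M : X.Modules) (U : X.Opens) : Module Γ(X, U) (dualSections M U) where
  smul r φ := ⟨fun V => resFun V r • φ.1 V, by
    intro V W hV hWV m
    have h : resFun ⟨W, hWV.trans hV⟩ r =
        X.presheaf.map (homOfLE hWV).op (resFun ⟨V, hV⟩ r) := by
      change X.presheaf.map (homOfLE (hWV.trans hV)).op r =
        X.presheaf.map (homOfLE hWV).op (X.presheaf.map (homOfLE hV).op r)
      rw [← CommRingCat.comp_apply, ← Functor.map_comp]; rfl
    simp only [LinearMap.smul_apply, smul_eq_mul, map_mul, φ.2 V W hV hWV m, h]⟩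
  one_smul φ := Subtype.ext (funext fun V => by
    change resFun V 1 • φ.1 V = φ.1 V
    rw [map_one, one_smul])
  mul_smul r s φ := Subtype.ext (funext fun V => by
    change resFun V (r * s) • φ.1 V = resFun V r • resFun V s • φ.1 V
    rw [map_mul, mul_smul])
  smul_zero r := Subtype.ext (funext fun V => smul_zero (resFun V r))
  smul_add r φ ψ := Subtype.ext (funext fun V => smul_add (resFun V r) (φ.1 V) (ψ.1 V))
  add_smul r s φ := Subtype.ext (funext fun V => by
    change resFun V (r + s) • φ.1 V = resFun V r • φ.1 V + resFun V s • φ.1 V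
    rw [map_add, add_smul])
  zero_smul φ := Subtype.ext (funext fun V => by
    change resFun V 0 • φ.1 V = 0
    rw [map_zero, zero_smul])

/-- The presheaf `U ↦ Hom_{𝒪_U}(M|_U, 𝒪_U)` of abelian groups. -/
def dualPresheafAb (M : X.Modules) : X.Opensᵒᵖ ⥤ Ab.{0} where
  obj U := AddCommGrpCat.of (dualSections M U.unop)
  map i := AddCommGrpCat.ofHom
    { toFun := fun φ => ⟨fun V => φ.1 ⟨V.1, V.2.trans (leOfHom i.unop)⟩,
        fun V W hV hWV m => φ.2 V W (hV.trans (leOfHom i.unop)) hWV m⟩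
      map_zero' := rfl
      map_add' := fun _ _ => rfl }
  map_id _ := rfl
  map_comp _ _ := rfl

instance (M : X.Modules) (U : X.Opensᵒᵖ) :
    Module (X.ringCatSheaf.obj.obj U) ((dualPresheafAb M).obj U) :=
  inferInstanceAs (Module Γ(X, U.unop) (dualSections M U.unop))

theorem dualPresheafAb_map_smul (M : X.Modules) ⦃U V : X.Opensᵒᵖ⦄ (i : U ⟶ V)
    (r : X.ringCatSheaf.obj.obj U) (φ : (dualPresheafAb M).obj U) :
    (dualPresheafAb M).map i (r • φ) =
      X.ringCatSheaf.obj.map i r • (dualPresheafAb M).map i φ := by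
  refine Subtype.ext (funext fun W => ?_)
  have h : ∀ r : X.presheaf.obj U,
      resFun (⟨W.1, W.2.trans (leOfHom i.unop)⟩ : {W : X.Opens // W ≤ U.unop}) r =
        resFun W (X.presheaf.map i r) := by
    intro r
    change X.presheaf.map _ r = X.presheaf.map (homOfLE W.2).op (X.presheaf.map i r)
    rw [← CommRingCat.comp_apply, ← Functor.map_comp]; rfl
  exact congrArg (fun a => a • φ.1 ⟨W.1, W.2.trans (leOfHom i.unop)⟩) (h r)

/-- The dual `ℋom(M, 𝒪_X)`; for a line bundle `M` this is `M^{-1}`. (The presheaf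
`U ↦ Hom_{𝒪_U}(M|_U, 𝒪_U)` is already a sheaf, so that sheafifying does not change it.) -/
def dual (M : X.Modules) : X.Modules :=
  sheafify (PresheafOfModules.ofPresheaf (dualPresheafAb M) (dualPresheafAb_map_smul M))

/-! ### Vector bundles, coherent sheaves -/

/-- `E` is locally free of rank `r`: on the members of some open cover it is isomorphic to the
free module on `r` generators. -/
def IsLocallyFreeOfRank (E : X.Modules) (r : ℕ) : Prop :=
  ∃ q : SheafOfModules.LocalGeneratorsData.{0} (R := X.ringCatSheaf) E,
    q.IsLocallyFreeData ∧ ∀ i, Nonempty ((q.generators i).I ≃ Fin r)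

/-- Vector bundles (on a connected scheme): locally free sheaves of finite rank. -/
def IsVectorBundle (E : X.Modules) : Prop := ∃ r : ℕ, IsLocallyFreeOfRank E r

/-- Line bundles: locally free sheaves of rank one. -/
def IsLineBundle (L : X.Modules) : Prop := IsLocallyFreeOfRank L 1

/-- Coherent sheaves (on a locally Noetherian scheme): `𝒪_X`-modules of finite presentation. -/
def IsCoherent (F : X.Modules) : Prop :=
  SheafOfModules.IsFinitePresentation (R := X.ringCatSheaf) F

/-! ### Stalks, fibres, global generation -/

/-- The underlying presheaf of modules of a sheaf of modules. -/
def toPresheafOfModules (E : X.Modules) :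
    PresheafOfModules (X.presheaf ⋙ forget₂ CommRingCat RingCat) := E.val

/-- The `𝒪_{X,x}`-module structure of the stalk `E_x`. -/
instance stalkModule (E : X.Modules) (x : X) :
    Module (X.presheaf.stalk x) (TopCat.Presheaf.stalk E.presheaf x :) :=
  inferInstanceAs (Module (X.presheaf.stalk x)
    (TopCat.Presheaf.stalk (toPresheafOfModules E).presheaf x :))

/-- The germ at `x` of a global section. -/
def germ (E : X.Modules) (x : X) (s : Γ(E, ⊤)) : (TopCat.Presheaf.stalk E.presheaf x :) :=
  TopCat.Presheaf.germ E.presheaf ⊤ x (Set.mem_univ x) s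

/-- The residue field `κ(x)`. -/
abbrev ResField (X : Scheme.{0}) (x : X) : Type := IsLocalRing.ResidueField (X.presheaf.stalk x)

/-- The fibre `E(x) = κ(x) ⊗ E_x`. -/
abbrev Fibre (E : X.Modules) (x : X) : Type :=
  ResField X x ⊗[X.presheaf.stalk x] (TopCat.Presheaf.stalk E.presheaf x :)

/-- The evaluation map `H⁰(X, E) → E(x)`. -/
def evalAt (E : X.Modules) (x : X) (s : Γ(E, ⊤)) : Fibre E x := 1 ⊗ₜ germ E x s

/-- The base locus: the points `x` where the evaluation map `H⁰(X, E) ⊗ κ(x) → E(x)` is not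
surjective. (At a closed point of a variety over `ℂ` one has `κ(x) = ℂ`, and this says that
`H⁰(X, E) → E(x)` is not surjective.) -/
def baseLocus (E : X.Modules) : Set X :=
  { x | Submodule.span (ResField X x) (Set.range (evalAt E x)) ≠ ⊤ }

/-- `F` is generated by global sections: their germs generate all stalks. -/
def IsGloballyGenerated (F : X.Modules) : Prop :=
  ∀ x : X, Submodule.span (X.presheaf.stalk x) (Set.range (germ F x)) = ⊤

/-- A line bundle `A` (on a Noetherian scheme) is ample if for every coherent sheaf `F` the
sheaves `F ⊗ A^n` are globally generated for all large `n`. -/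
def IsAmple (A : X.Modules) : Prop :=
  IsLineBundle A ∧ ∀ F : X.Modules, IsCoherent F →
    ∃ n₀ : ℕ, ∀ n : ℕ, n₀ ≤ n → IsGloballyGenerated (tensor F (tensorPow A n))

/-! ### Asymptotic base loci and positivity -/

/-- The stable base locus `𝔹(E) = ⋂_{m > 0} Bs(Sym^m E)`. -/
def stableBaseLocus (E : X.Modules) : Set X :=
  ⋂ (m : ℕ) (_ : 0 < m), baseLocus (sym m E)

/-- The augmented base locus `𝔹₊(E) = ⋂ 𝔹(E - rA)` over all rationals `r = p / q > 0`, where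
`𝔹(E - rA) = 𝔹(Sym^q E ⊗ A^{-p})`. -/
def augmentedBaseLocus (A E : X.Modules) : Set X :=
  ⋂ (p : ℕ) (_ : 0 < p) (q : ℕ) (_ : 0 < q),
    stableBaseLocus (tensor (sym q E) (tensorPow (dual A) p))

/-- The restricted base locus `𝔹₋(E) = ⋃ 𝔹(E + rA)` over all rationals `r = p / q > 0`, where
`𝔹(E + rA) = 𝔹(Sym^q E ⊗ A^p)`. -/
def restrictedBaseLocus (A E : X.Modules) : Set X :=
  ⋃ (p : ℕ) (_ : 0 < p) (q : ℕ) (_ : 0 < q),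
    stableBaseLocus (tensor (sym q E) (tensorPow A p))

/-- `E` is pseudo-effective: `𝔹₋(E) ≠ X`, the locus being formed with `H`. -/
def IsPseudoEffective (H E : X.Modules) : Prop :=
  restrictedBaseLocus H E ≠ Set.univ

/-- `E` is weakly positive: the closure of `𝔹₋(E)` is not `X`. -/
def IsWeaklyPositive (H E : X.Modules) : Prop :=
  closure (restrictedBaseLocus H E) ≠ Set.univ

/-- `E` is V-big: `Sym^c E ⊗ A^{-1}` is weakly positive for some ample `A` and some `c > 0`. -/
def IsVBig (H E : X.Modules) : Prop :=
  ∃ A : X.Modules, IsAmple A ∧ ∃ c : ℕ, 0 < c ∧ IsWeaklyPositive H (tensor (sym c E) (dual A))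

/-! ### Projective varieties -/

attribute [local instance] MvPolynomial.gradedAlgebra

/-- Projective `n`-space over `ℂ`. -/
def projSpace (n : ℕ) : Scheme.{0} :=
  Proj (MvPolynomial.homogeneousSubmodule (Fin (n + 1)) ℂ)

/-- The structure morphism of projective space. -/
def projSpaceToSpec (n : ℕ) : projSpace n ⟶ Spec (.of ℂ) :=
  Proj.toSpecZero (MvPolynomial.homogeneousSubmodule (Fin (n + 1)) ℂ) ≫
    Spec.map (CommRingCat.ofHom
      (algebraMap ℂ (MvPolynomial.homogeneousSubmodule (Fin (n + 1)) ℂ 0)))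

/-- A complex scheme is projective if it is a closed subscheme of some projective space. -/
def IsProjective (f : X ⟶ Spec (.of ℂ)) : Prop :=
  ∃ (n : ℕ) (i : X ⟶ projSpace n), IsClosedImmersion i ∧ i ≫ projSpaceToSpec n = f

end VB

end

/-! Let K be the function field of the integral scheme X. A locally free sheaf E of rank r embeds in
the constant sheaf K^r and becomes a family of lattices Λ_y over the local rings 𝒪_y ⊆ K. Sections
over a nonempty open U are the elements of ⋂_{y∈U} Λ_y, and a line bundle is a family of units c_y,
its local generators. Tensoring with the line bundle multiplies Λ_y by c_y, dualizing a line bundle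
inverts c_y, and Sym^n E corresponds to Λ_y^n inside the symmetric algebra of K^r. By Nakayama, x
lies outside the base locus exactly when Λ_x is spanned over 𝒪_x by ⋂_y Λ_y (`Realizes.isGG_iff`).
Hence generation at x passes to images and products, in particular along the multiplication
Sym^m(Sym^q E ⊗ L) → Sym^{qm} E ⊗ L^m, and it is an open condition on x.

From pseudo-effectivity to 𝔹₊ ≠ X (`augmentedBaseLocus_ne_univ_of_isPseudoEffective`): let x lie
outside 𝔹₋^H(Sym^c E ⊗ A^{-1}). For every N some Sym^{cNk} E ⊗ A^{-Nk} ⊗ H^k is generated at x.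
Ampleness of A lets N be written so that A^N ⊗ H^{-1} ⊗ H'^{-1} is a product of two globally
generated bundles. Multiplying by its k-th power gives Sym^{cNk} E ⊗ H'^{-k} generated at x, whence
x ∉ 𝔹₊^{H'}(E).

From 𝔹₊ ≠ X to V-big (`exists_isWeaklyPositive_of_augmentedBaseLocus_ne_univ`): a point outside
𝔹₊^H(E) gives a Sym^a E ⊗ H^{-b} generated there with a, b > 0. After taking a power and giving back
all but one factor H^{-1}, some F = Sym^c E ⊗ H^{-1} is generated at x, hence on an open U ∋ x.
Twists of symmetric powers of F by any ample H' then have stable base locus away from U, so 𝔹₋(F)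
lies in the proper closed set X ∖ U. Weak positivity implies pseudo-effectivity, and both
implications allow arbitrary auxiliary bundles, which closes the circle. -/

noncomputable section

namespace VB

variable {X : Scheme.{0}}

/-! ### Sections, sheafification and local generation -/

/-- Sections of a presheaf of modules. -/
abbrev Sec (P : X.PresheafOfModules) (U : X.Opens) : Type := P.presheaf.obj (op U)

instance (P : X.PresheafOfModules) (U : X.Opens) : Module Γ(X, U) (Sec P U) :=
  (P.obj (op U)).isModule

/-- Restriction of sections. -/
def rs (P : X.PresheafOfModules) {U V : X.Opens} (h : V ≤ U) : Sec P U →+ Sec P V :=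
  (P.presheaf.map (homOfLE h).op).hom

/-- Restriction of functions. -/
def rf {U V : X.Opens} (h : V ≤ U) : Γ(X, U) →+* Γ(X, V) :=
  (X.presheaf.map (homOfLE h).op).hom

theorem rs_rs (P : X.PresheafOfModules) {U V W : X.Opens} (h : V ≤ U) (h' : W ≤ V) (s : Sec P U) :
    rs P h' (rs P h s) = rs P (h'.trans h) s := by
  have := P.presheaf.map_comp (homOfLE h).op (homOfLE h').op
  exact (congrArg (fun f => f.hom s) this).symm

theorem rs_refl (P : X.PresheafOfModules) {U : X.Opens} (h : U ≤ U) (s : Sec P U) :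
    rs P h s = s :=
  congrArg (fun f => f.hom s) (P.presheaf.map_id (op U))

theorem rs_smul (P : X.PresheafOfModules) {U V : X.Opens} (h : V ≤ U) (a : Γ(X, U)) (s : Sec P U) :
    rs P h (a • s) = rf h a • rs P h s :=
  P.map_smul (homOfLE h).op a s

/-- The unit of sheafification on sections. -/
def toSh (P : X.PresheafOfModules) (U : X.Opens) : Sec P U →ₗ[Γ(X, U)] Sec (sheafify P).val U where
  toFun := (((PresheafOfModules.sheafificationAdjunction
    (𝟙 X.ringCatSheaf.obj)).unit.app P).app (op U)).hom
  map_add' := map_add _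
  map_smul' a s := (((PresheafOfModules.sheafificationAdjunction
    (𝟙 X.ringCatSheaf.obj)).unit.app P).app (op U)).hom.map_smul a s

theorem toSh_rs (P : X.PresheafOfModules) {U V : X.Opens} (h : V ≤ U) (s : Sec P U) :
    toSh P V (rs P h s) = rs _ h (toSh P U s) :=
  congrArg (fun f => f.hom s)
    ((CategoryTheory.toSheafify (Opens.grothendieckTopology X) P.presheaf).naturality
      (homOfLE h).op)

/-- Apart from naturality, sheafification enters only through this local injectivity of its unit and
the local surjectivity `toSh_locSurj`. -/
theorem toSh_locInj (P : X.PresheafOfModules) {U : X.Opens} (s t : Sec P U)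
    (h : toSh P U s = toSh P U t) (y : X) (hy : y ∈ U) :
    ∃ (V : X.Opens) (hV : V ≤ U), y ∈ V ∧ rs P hV s = rs P hV t := by
  have := Presheaf.equalizerSieve_mem (Opens.grothendieckTopology X)
    (CategoryTheory.toSheafify (Opens.grothendieckTopology X) P.presheaf) (X := op U) s t h
  obtain ⟨V, f, hf, hy⟩ := this y hy
  exact ⟨V, leOfHom f, hy, hf⟩

theorem toSh_locSurj (P : X.PresheafOfModules) {U : X.Opens} (s : Sec (sheafify P).val U)
    (y : X) (hy : y ∈ U) :
    ∃ (V : X.Opens) (hV : V ≤ U), y ∈ V ∧ ∃ t : Sec P V, toSh P V t = rs _ hV s := by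
  have := Presheaf.imageSieve_mem (Opens.grothendieckTopology X)
    (CategoryTheory.toSheafify (Opens.grothendieckTopology X) P.presheaf) (U := op U) s
  obtain ⟨V, f, ⟨t, hf⟩, hy⟩ := this y hy
  exact ⟨V, leOfHom f, hy, t, hf⟩

/-- Sections `e i` over `U` generate the presheaf of modules `P` locally on `U`. -/
def Gen (P : X.PresheafOfModules) (U : X.Opens) {ι : Type} (e : ι → Sec P U) : Prop :=
  ∀ (W : X.Opens) (s : Sec P W) (y : X), y ∈ U → y ∈ W →
    ∃ (W' : X.Opens) (hU : W' ≤ U) (hW : W' ≤ W), y ∈ W' ∧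
      rs P hW s ∈ Submodule.span Γ(X, W') (Set.range fun i => rs P hU (e i))

theorem rs_mem_span (P : X.PresheafOfModules) {ι : Type} {U W : X.Opens} (h : W ≤ U)
    (e : ι → Sec P U) (s : Sec P U) (hs : s ∈ Submodule.span Γ(X, U) (Set.range e)) :
    rs P h s ∈ Submodule.span Γ(X, W) (Set.range fun i => rs P h (e i)) := by
  induction hs using Submodule.span_induction with
  | mem x hx =>
    obtain ⟨i, rfl⟩ := hx
    exact Submodule.subset_span ⟨i, rfl⟩
  | zero => rw [map_zero]; exact Submodule.zero_mem _
  | add x y _ _ hx hy => rw [map_add]; exact Submodule.add_mem _ hx hy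
  | smul a x _ hx => rw [rs_smul]; exact Submodule.smul_mem _ _ hx

theorem rs_mem_span_rs (P : X.PresheafOfModules) {ι : Type} {U V W : X.Opens} (h : V ≤ U)
    (h' : W ≤ V) (e : ι → Sec P U) (s : Sec P V)
    (hs : s ∈ Submodule.span Γ(X, V) (Set.range fun i => rs P h (e i))) :
    rs P h' s ∈ Submodule.span Γ(X, W) (Set.range fun i => rs P (h'.trans h) (e i)) := by
  have := rs_mem_span P h' (fun i => rs P h (e i)) s hs
  simpa only [rs_rs] using this

theorem Gen.mono {P : X.PresheafOfModules} {U V : X.Opens} {ι : Type} {e : ι → Sec P U}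
    (he : Gen P U e) (h : V ≤ U) : Gen P V (fun i => rs P h (e i)) := by
  intro W s y hy hyW
  obtain ⟨W', hU, hW, hy', hs⟩ := he W s y (h hy) hyW
  refine ⟨W' ⊓ V, inf_le_right, inf_le_left.trans hW, ⟨hy', hy⟩, ?_⟩
  have := rs_mem_span_rs P hU (inf_le_left : W' ⊓ V ≤ W') e _ hs
  simpa only [rs_rs] using this

theorem Gen.sheafify {P : X.PresheafOfModules} {U : X.Opens} {ι : Type} {e : ι → Sec P U}
    (he : Gen P U e) : Gen (sheafify P).val U (fun i => toSh P U (e i)) := by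
  intro W s y hy hyW
  obtain ⟨V, hV, hyV, t, ht⟩ := toSh_locSurj P s y hyW
  obtain ⟨W', hU, hW, hy', hs⟩ := he V t y hy hyV
  refine ⟨W', hU, hW.trans hV, hy', ?_⟩
  have := Submodule.mem_map_of_mem (f := toSh P W') hs
  rw [toSh_rs, ht, rs_rs, Submodule.map_span, ← Set.range_comp] at this
  simpa only [Function.comp_def, toSh_rs] using this

/-! ### Realizations in vector spaces over the function field, and their lattices -/

section

variable [IsIntegral X]

/-- The function field. -/
def FF (X : Scheme.{0}) [IsIntegral X] : Type := X.functionField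

instance : Field (FF X) := inferInstanceAs (Field X.functionField)

/-- The germ of a function at the generic point. -/
def gK {U : X.Opens} (h : genericPoint X ∈ U) : Γ(X, U) →+* FF X :=
  (X.presheaf.germ U _ h).hom

theorem gK_injective {U : X.Opens} (h : genericPoint X ∈ U) : Function.Injective (gK h) :=
  germ_injective_of_isIntegral _ _ h

theorem gK_rf {U V : X.Opens} (hV : genericPoint X ∈ V) (h : V ≤ U) (a : Γ(X, U)) :
    gK hV (rf h a) = gK (h hV) a :=
  X.presheaf.germ_res_apply (homOfLE h) _ hV a

theorem generic_mem {U : X.Opens} {y : X} (hy : y ∈ U) : genericPoint X ∈ U :=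
  ((genericPoint_spec X).mem_open_set_iff U.isOpen).mpr ⟨y, trivial, hy⟩

/-- The embedding of a local ring into the function field. -/
def stalkToFF (y : X) : X.presheaf.stalk y →+* FF X :=
  algebraMap (X.presheaf.stalk y) X.functionField

theorem stalkToFF_germ {U : X.Opens} {y : X} (hy : y ∈ U) (a : Γ(X, U)) :
    stalkToFF y (X.presheaf.germ U y hy a) = gK (generic_mem hy) a := by
  have : Nonempty U := ⟨⟨y, hy⟩⟩
  exact Scheme.algebraMap_germ_eq_germToFunctionField X hy a

/-- The local ring at a point as a subring of the function field. -/
def loc (y : X) : Subring (FF X) := (stalkToFF y).range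

theorem gK_mem_loc {U : X.Opens} {y : X} (hy : y ∈ U) (a : Γ(X, U)) :
    gK (generic_mem hy) a ∈ loc y :=
  ⟨_, stalkToFF_germ hy a⟩

theorem mem_loc {y : X} {c : FF X} :
    c ∈ loc y ↔ ∃ (U : X.Opens) (hy : y ∈ U) (a : Γ(X, U)), gK (generic_mem hy) a = c := by
  constructor
  · rintro ⟨z, rfl⟩
    obtain ⟨U, hy, a, rfl⟩ := X.presheaf.exists_germ_eq z
    exact ⟨U, hy, a, (stalkToFF_germ hy a).symm⟩
  · rintro ⟨U, hy, a, rfl⟩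
    exact gK_mem_loc hy a

/-- A realization of a presheaf of modules in a vector space over the function field. -/
structure Rlz (P : X.PresheafOfModules) (V : Type) [AddCommGroup V] [Module (FF X) V] where
  val : ∀ (U : X.Opens), genericPoint X ∈ U → Sec P U →+ V
  val_rs : ∀ {U W : X.Opens} (h : W ≤ U) (hW : genericPoint X ∈ W) (s : Sec P U),
    val W hW (rs P h s) = val U (h hW) s
  val_smul : ∀ {U : X.Opens} (h : genericPoint X ∈ U) (a : Γ(X, U)) (s : Sec P U),
    val U h (a • s) = gK h a • val U h s

variable {V : Type} [AddCommGroup V] [Module (FF X) V]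

namespace Rlz

variable {P : X.PresheafOfModules}

/-- Makes the value of a section of the associated sheaf independent of the local preimage: two
preimages become equal near the generic point, and restriction does not change values. -/
theorem val_eq_of_toSh (ρ : Rlz P V) {U U' : X.Opens} (h : genericPoint X ∈ U)
    (h' : genericPoint X ∈ U') (s : Sec P U) (s' : Sec P U')
    {W : X.Opens} (hU : U ≤ W) (hU' : U' ≤ W)
    (t : Sec (sheafify P).val W)
    (hs : toSh P U s = rs _ hU t) (hs' : toSh P U' s' = rs _ hU' t) :
    ρ.val U h s = ρ.val U' h' s' := by
  obtain ⟨V, hV, hη, hst⟩ := toSh_locInj P (U := U ⊓ U') (rs P inf_le_left s) (rs P inf_le_right s')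
    (by rw [toSh_rs, toSh_rs, hs, hs', rs_rs, rs_rs]) _ ⟨h, h'⟩
  rw [rs_rs, rs_rs] at hst
  rw [← ρ.val_rs (hV.trans inf_le_left) hη s, hst, ρ.val_rs]

/-- The value of a section of the associated sheaf. -/
def shVal (ρ : Rlz P V) (U : X.Opens) (h : genericPoint X ∈ U) (s : Sec (sheafify P).val U) : V :=
  ρ.val _ (toSh_locSurj P s _ h).choose_spec.choose_spec.1
    (toSh_locSurj P s _ h).choose_spec.choose_spec.2.choose

theorem shVal_eq (ρ : Rlz P V) {U W : X.Opens} (h : genericPoint X ∈ U) (s : Sec (sheafify P).val U)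
    (hW : genericPoint X ∈ W) (hWU : W ≤ U) (t : Sec P W) (ht : toSh P W t = rs _ hWU s) :
    ρ.shVal U h s = ρ.val W hW t :=
  ρ.val_eq_of_toSh _ _ _ _ (toSh_locSurj P s _ h).choose_spec.choose hWU s
    (toSh_locSurj P s _ h).choose_spec.choose_spec.2.choose_spec ht

/-- Realizations extend to the associated sheaf. -/
def sh (ρ : Rlz P V) : Rlz (sheafify P).val V where
  val U h :=
    { toFun := ρ.shVal U h
      map_zero' := by
        rw [ρ.shVal_eq h 0 h le_rfl 0 (by rw [map_zero, map_zero]), map_zero]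
      map_add' s s' := by
        obtain ⟨W, hW, hη, t, ht⟩ := toSh_locSurj P s _ h
        obtain ⟨W', hW', hη', t', ht'⟩ := toSh_locSurj P s' _ h
        have e : toSh P (W ⊓ W') (rs P inf_le_left t) = rs _ (inf_le_left.trans hW) s := by
          rw [toSh_rs, ht, rs_rs]
        have e' : toSh P (W ⊓ W') (rs P inf_le_right t') = rs _ (inf_le_left.trans hW) s' := by
          rw [toSh_rs, ht', rs_rs]
        have e'' : toSh P (W ⊓ W') (rs P inf_le_left t + rs P inf_le_right t') =
            rs _ (inf_le_left.trans hW) (s + s') := by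
          rw [map_add, e, e']; exact (map_add (rs _ _) s s').symm
        exact (ρ.shVal_eq h (s + s') (W := W ⊓ W') ⟨hη, hη'⟩ _ _ e'').trans ((map_add _ _ _).trans
          (congrArg₂ (· + ·) (ρ.shVal_eq h s (W := W ⊓ W') ⟨hη, hη'⟩ _ _ e).symm
            (ρ.shVal_eq h s' (W := W ⊓ W') ⟨hη, hη'⟩ _ _ e').symm)) }
  val_rs {U U'} h hW s := by
    obtain ⟨W, hW', hη, t, ht⟩ := toSh_locSurj P (rs _ h s) _ hW
    exact (ρ.shVal_eq hW _ hη hW' t ht).trans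
      (ρ.shVal_eq (h hW) s hη (hW'.trans h) t (by rw [ht, rs_rs])).symm
  val_smul {U} h a s := by
    obtain ⟨W, hW', hη, t, ht⟩ := toSh_locSurj P s _ h
    change ρ.shVal U h _ = gK h a • ρ.shVal U h s
    rw [ρ.shVal_eq h s hη hW' t ht, ρ.shVal_eq h (a • s) hη hW' (rf hW' a • t)
      (by rw [map_smul, ht, rs_smul]), ρ.val_smul, gK_rf]

theorem sh_toSh (ρ : Rlz P V) {U : X.Opens} (h : genericPoint X ∈ U) (s : Sec P U) :
    ρ.sh.val U h (toSh P U s) = ρ.val U h s :=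
  ρ.shVal_eq h _ h le_rfl s (rs_refl _ _ _).symm

/-- Composition with a linear map. -/
def comp {W : Type} [AddCommGroup W] [Module (FF X) W] (ρ : Rlz P V)
    (f : V →ₗ[FF X] W) : Rlz P W where
  val U h := f.toAddMonoidHom.comp (ρ.val U h)
  val_rs h hW s := congrArg f (ρ.val_rs h hW s)
  val_smul h a s := by
    change f _ = _ • f _
    rw [ρ.val_smul, map_smul]

end Rlz

/-- Local generators exist whose values are linearly independent. -/
def Rlz.IsGood {P : X.PresheafOfModules} (ρ : Rlz P V) : Prop :=
  ∀ y : X, ∃ (U : X.Opens) (hy : y ∈ U) (ι : Type) (_ : Finite ι) (e : ι → Sec P U),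
    Gen P U e ∧ LinearIndependent (FF X) fun i => ρ.val U (generic_mem hy) (e i)

theorem Rlz.IsGood.sh {P : X.PresheafOfModules} {ρ : Rlz P V} (h : ρ.IsGood) : ρ.sh.IsGood := by
  intro y
  obtain ⟨U, hy, ι, hι, e, he, hli⟩ := h y
  refine ⟨U, hy, ι, hι, _, he.sheafify, ?_⟩
  simpa only [Rlz.sh_toSh] using hli

section lattice

/-- The lattice at a point attached to a realization. -/
def Rlz.lat {P : X.PresheafOfModules} (ρ : Rlz P V) (y : X) :
    Submodule (loc y) V :=
  Submodule.span _
    { v | ∃ (U : X.Opens) (hy : y ∈ U) (s : Sec P U), ρ.val U (generic_mem hy) s = v }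

/-- The span adds nothing: neighbourhoods of `y` can be intersected, and an element of `loc y` is a
function on some neighbourhood, so the values are already closed under both operations. -/
theorem Rlz.mem_lat {P : X.PresheafOfModules} (ρ : Rlz P V) {y : X} {v : V} :
    v ∈ ρ.lat y ↔ ∃ (U : X.Opens) (hy : y ∈ U) (s : Sec P U), ρ.val U (generic_mem hy) s = v := by
  refine ⟨fun h => ?_, fun h => Submodule.subset_span h⟩
  induction h using Submodule.span_induction with
  | mem x hx => exact hx
  | zero => exact ⟨⊤, trivial, 0, map_zero _⟩
  | add v w _ _ hv hw =>
    obtain ⟨U, hU, s, rfl⟩ := hv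
    obtain ⟨W, hW, t, rfl⟩ := hw
    refine ⟨U ⊓ W, ⟨hU, hW⟩, rs P inf_le_left s + rs P inf_le_right t, ?_⟩
    rw [map_add, ρ.val_rs, ρ.val_rs]
  | smul a v _ hv =>
    obtain ⟨U, hU, s, rfl⟩ := hv
    obtain ⟨c, hc⟩ := a
    obtain ⟨W, hW, b, rfl⟩ := mem_loc.mp hc
    refine ⟨U ⊓ W, ⟨hU, hW⟩,
      rf (inf_le_right : U ⊓ W ≤ W) b • rs P (inf_le_left : U ⊓ W ≤ U) s, ?_⟩
    rw [ρ.val_smul, ρ.val_rs, gK_rf]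
    rfl

theorem Rlz.lat_eq_span {P : X.PresheafOfModules} (ρ : Rlz P V) {U : X.Opens} {ι : Type}
    {e : ι → Sec P U} (he : Gen P U e) {y : X} (hy : y ∈ U) :
    ρ.lat y = Submodule.span _ (Set.range fun i => ρ.val U (generic_mem hy) (e i)) := by
  refine le_antisymm ?_ (Submodule.span_le.mpr ?_)
  · intro v hv
    obtain ⟨W, hW, s, rfl⟩ := ρ.mem_lat.mp hv
    obtain ⟨W', hU', hW', hy', hs⟩ := he W s y hy hW
    rw [← ρ.val_rs hW' (generic_mem hy')]
    generalize rs P hW' s = t at hs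
    induction hs using Submodule.span_induction with
    | mem x hx =>
      obtain ⟨i, rfl⟩ := hx
      exact Submodule.subset_span ⟨i, (ρ.val_rs hU' (generic_mem hy') (e i)).symm⟩
    | zero => rw [map_zero]; exact Submodule.zero_mem _
    | add x y _ _ hx hy => rw [map_add]; exact Submodule.add_mem _ hx hy
    | smul a x _ hx =>
      rw [ρ.val_smul]
      exact Submodule.smul_mem _ (⟨_, gK_mem_loc hy' a⟩ : loc y) hx
  · rintro _ ⟨i, rfl⟩
    exact ρ.mem_lat.mpr ⟨U, hy, e i, rfl⟩

theorem Rlz.lat_sh {P : X.PresheafOfModules} (ρ : Rlz P V) (y : X) : ρ.sh.lat y = ρ.lat y := by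
  ext v
  rw [ρ.mem_lat, ρ.sh.mem_lat]
  constructor
  · rintro ⟨U, hy, s, rfl⟩
    obtain ⟨W, hW, hyW, t, ht⟩ := toSh_locSurj P s y hy
    exact ⟨W, hyW, t, by rw [← ρ.sh_toSh, ht, ρ.sh.val_rs]⟩
  · rintro ⟨U, hy, s, rfl⟩
    exact ⟨U, hy, toSh P U s, ρ.sh_toSh _ s⟩

/-- A family of lattices is generated at `x` by its global elements. -/
def IsGG (Λ : ∀ y : X, Submodule (loc y) V) (x : X) : Prop :=
  Λ x ≤ Submodule.span _ { v | ∀ y, v ∈ Λ y }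

end lattice

end

/-! ### Presheaf tensor products and symmetric powers -/

/-- The presheaf tensor product. -/
def tensorPre (P Q : X.PresheafOfModules) : X.PresheafOfModules :=
  PresheafOfModules.Monoidal.tensorObj (R := X.presheaf) P Q

/-- Pure tensors of sections. -/
def tm {P Q : X.PresheafOfModules} {U : X.Opens} :
    Sec P U →ₗ[Γ(X, U)] Sec Q U →ₗ[Γ(X, U)] Sec (tensorPre P Q) U :=
  TensorProduct.mk Γ(X, U) (Sec P U) (Sec Q U)

theorem rs_tm {P Q : X.PresheafOfModules} {U W : X.Opens} (h : W ≤ U) (p : Sec P U) (q : Sec Q U) :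
    rs (tensorPre P Q) h (tm p q) = tm (rs P h p) (rs Q h q) := rfl

theorem tm_induction {P Q : X.PresheafOfModules} {U : X.Opens}
    {C : Sec (tensorPre P Q) U → Prop} (h0 : C 0) (htm : ∀ p q, C (tm p q))
    (hadd : ∀ s t, C s → C t → C (s + t)) (s : Sec (tensorPre P Q) U) : C s :=
  let C' : TensorProduct Γ(X, U) (Sec P U) (Sec Q U) → Prop := C
  TensorProduct.induction_on (motive := C') s h0 htm hadd

theorem Gen.tensor {P Q : X.PresheafOfModules} {U : X.Opens} {ι κ : Type} {e : ι → Sec P U}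
    {f : κ → Sec Q U} (he : Gen P U e) (hf : Gen Q U f) :
    Gen (tensorPre P Q) U (fun i : ι × κ => tm (e i.1) (f i.2)) := by
  intro W s y hy hyW
  induction s using tm_induction with
  | h0 => exact ⟨U ⊓ W, inf_le_left, inf_le_right, ⟨hy, hyW⟩, by rw [map_zero]; exact zero_mem _⟩
  | htm p q =>
    obtain ⟨W₁, hU₁, hW₁, hy₁, h₁⟩ := he W p y hy hyW
    obtain ⟨W₂, hU₂, hW₂, hy₂, h₂⟩ := hf W q y hy hyW
    refine ⟨W₁ ⊓ W₂, inf_le_left.trans hU₁, inf_le_left.trans hW₁, ⟨hy₁, hy₂⟩, ?_⟩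
    have h₁' := rs_mem_span_rs P hU₁ (inf_le_left : W₁ ⊓ W₂ ≤ W₁) e _ h₁
    have h₂' := rs_mem_span_rs Q hU₂ (inf_le_right : W₁ ⊓ W₂ ≤ W₂) f _ h₂
    rw [rs_rs] at h₁' h₂'
    rw [rs_tm]
    have := Submodule.apply_mem_map₂ tm h₁' h₂'
    rw [Submodule.map₂_span_span] at this
    refine Submodule.span_mono ?_ this
    rintro _ ⟨_, ⟨i, rfl⟩, _, ⟨j, rfl⟩, rfl⟩
    exact ⟨(i, j), rs_tm _ _ _⟩
  | hadd s t hs ht =>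
    obtain ⟨W₁, hU₁, hW₁, hy₁, h₁⟩ := hs
    obtain ⟨W₂, hU₂, hW₂, hy₂, h₂⟩ := ht
    refine ⟨W₁ ⊓ W₂, inf_le_left.trans hU₁, inf_le_left.trans hW₁, ⟨hy₁, hy₂⟩, ?_⟩
    have h₁' := rs_mem_span_rs _ hU₁ (inf_le_left : W₁ ⊓ W₂ ≤ W₁) _ _ h₁
    have h₂' := rs_mem_span_rs _ hU₂ (inf_le_right : W₁ ⊓ W₂ ≤ W₂) _ _ h₂
    rw [rs_rs] at h₁' h₂'
    rw [map_add]
    exact add_mem h₁' h₂'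

/-- The presheaf of symmetric powers. -/
def symPre (n : ℕ) (M : X.Modules) : X.PresheafOfModules :=
  PresheafOfModules.ofPresheaf (symPresheafAb M n)
    (fun _ _ i r m => SymPow.map_smul (X.presheaf.map i).hom (res M i) n r m)

/-- Products of sections in the symmetric power. -/
def sp {n : ℕ} {M : X.Modules} {U : X.Opens} :
    MultilinearMap Γ(X, U) (fun _ : Fin n => Sec M.val U) (Sec (symPre n M) U) :=
  SymmetricPower.tprod Γ(X, U) (ι := Fin n) (M := Sec M.val U)

theorem rs_sp {n : ℕ} {M : X.Modules} {U W : X.Opens} (h : W ≤ U) (m : Fin n → Sec M.val U) :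
    rs (symPre n M) h (sp m) = sp (fun i => rs M.val h (m i)) :=
  SymPow.map_tprod (X.presheaf.map (homOfLE h).op).hom (res M (homOfLE h).op) n m

theorem sp_perm {n : ℕ} {M : X.Modules} {U : X.Opens} (σ : Equiv.Perm (Fin n))
    (m : Fin n → Sec M.val U) : sp (fun i => m (σ i)) = sp m :=
  SymmetricPower.tprod_equiv σ m

theorem span_sp (n : ℕ) (M : X.Modules) (U : X.Opens) :
    Submodule.span Γ(X, U) (Set.range (sp : (Fin n → Sec M.val U) → Sec (symPre n M) U)) = ⊤ :=
  SymmetricPower.span_tprod_eq_top Γ(X, U) (Fin n) (Sec M.val U)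

end VB

/-! ### Combinatorics and linear algebra of symmetric powers -/

/-- Words with the same exponent vector are rearrangements of one another. This picks out one
product of generators of Sym^n per monomial. -/
theorem exists_perm_of_sum_single_eq {n : ℕ} {ι : Type} (f g : Fin n → ι)
    (h : ∑ i, Finsupp.single (f i) 1 = ∑ i, (Finsupp.single (g i) 1 : ι →₀ ℕ)) :
    ∃ σ : Equiv.Perm (Fin n), (fun i => g (σ i)) = f := by
  classical
  let : LinearOrder ι := linearOrderOfSTO WellOrderingRel
  have key : ∀ f : Fin n → ι, Multiset.toFinsupp (List.ofFn f : Multiset ι) =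
      ∑ i, Finsupp.single (f i) 1 := by
    intro f
    have : (List.ofFn f : Multiset ι) = ∑ i, {f i} := by
      rw [← Fin.univ_val_map, ← Multiset.sum_map_singleton (Multiset.map f _), Multiset.map_map]
      rfl
    rw [this, map_sum]
    simp only [Multiset.toFinsupp_singleton]
  rw [← key, ← key] at h
  have hp : (List.ofFn f).Perm (List.ofFn g) :=
    Multiset.coe_eq_coe.mp (Multiset.toFinsupp.injective h)
  -- Two sorted words with the same multiset of letters coincide; composing the sorting permutations
  -- gives σ.
  have hs : f ∘ Tuple.sort f = g ∘ Tuple.sort g := by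
    refine List.ofFn_injective (List.Perm.eq_of_pairwise' (r := (· ≤ ·)) ?_ ?_ ?_)
    · exact (Tuple.monotone_sort f).sortedLE_ofFn.pairwise
    · exact (Tuple.monotone_sort g).sortedLE_ofFn.pairwise
    · exact ((Tuple.sort f).ofFn_comp_perm f).trans
        (hp.trans ((Tuple.sort g).ofFn_comp_perm g).symm)
  refine ⟨(Tuple.sort f).symm.trans (Tuple.sort g), funext fun i => ?_⟩
  have := congrFun hs ((Tuple.sort f).symm i)
  simpa using this.symm

theorem multilinear_mem_span {R M N ι κ : Type} [CommSemiring R] [AddCommMonoid M] [Module R M]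
    [AddCommMonoid N] [Module R N] [Finite ι] [Fintype κ]
    (f : MultilinearMap R (fun _ : κ => M) N) (e : ι → M) (m : κ → M)
    (h : ∀ k, m k ∈ Submodule.span R (Set.range e)) :
    f m ∈ Submodule.span R (Set.range fun r : κ → ι => f fun k => e (r k)) := by
  classical
  have := Fintype.ofFinite ι
  choose c hc using fun k => (Submodule.mem_span_range_iff_exists_fun R).mp (h k)
  obtain rfl : (fun k => ∑ i, c k i • e i) = m := funext hc
  rw [f.map_sum]
  refine Submodule.sum_mem _ fun r _ => ?_
  rw [f.map_smul_univ]
  exact Submodule.smul_mem _ _ (Submodule.subset_span ⟨r, rfl⟩)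

namespace SymPow

/-- The additive map `m₁ ⋯ mₙ ↦ φ(m₁) ⋯ φ(mₙ)` to an algebra. -/
def lift {R S M A : Type} [CommRing R] [CommRing S] [AddCommGroup M] [CommRing A]
    [Module R M] [Algebra S A] (σ : R →+* S) (φ : M →ₛₗ[σ] A) (n : ℕ) :
    SymmetricPower R (Fin n) M →+ A :=
  letI : Module R A := Module.compHom _ σ
  let μ : MultilinearMap R (fun _ : Fin n => M) A :=
    { toFun := fun m => ∏ i, φ (m i)
      map_update_add' := by
        intro inst m i x y
        obtain rfl : inst = instDecidableEqFin n := Subsingleton.elim _ _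
        have key : ∀ z, (fun j => φ (Function.update m i z j)) =
            Function.update (fun j => φ (m j)) i (φ z) := by
          intro z; ext j; by_cases h : j = i
          · subst h; simp
          · simp [h]
        rw [key, key, key, map_add]
        exact (MultilinearMap.mkPiAlgebra S (Fin n) A).map_update_add _ _ _ _
      map_update_smul' := by
        intro inst m i c x
        obtain rfl : inst = instDecidableEqFin n := Subsingleton.elim _ _
        have key : ∀ z, (fun j => φ (Function.update m i z j)) =
            Function.update (fun j => φ (m j)) i (φ z) := by
          intro z; ext j; by_cases h : j = i
          · subst h; simp
          · simp [h]
        rw [key, key, map_smulₛₗ]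
        exact (MultilinearMap.mkPiAlgebra S (Fin n) A).map_update_smul _ _ _ _ }
  AddCon.lift _ (PiTensorProduct.lift μ).toAddMonoidHom (by
    refine AddCon.addConGen_le.mpr ?_
    rintro _ _ ⟨e, f⟩
    refine (AddCon.ker_rel _).mpr ?_
    rw [LinearMap.toAddMonoidHom_coe, PiTensorProduct.lift.tprod, PiTensorProduct.lift.tprod]
    exact (Equiv.prod_comp e (fun i => φ (f i))).symm)

theorem lift_tprod {R S M A : Type} [CommRing R] [CommRing S] [AddCommGroup M] [CommRing A]
    [Module R M] [Algebra S A] (σ : R →+* S) (φ : M →ₛₗ[σ] A) (n : ℕ) (m : Fin n → M) :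
    lift σ φ n (SymmetricPower.tprod R m) = ∏ i, φ (m i) := by
  let : Module R A := Module.compHom _ σ
  exact PiTensorProduct.lift.tprod (R := R) (s := fun _ : Fin n => M) m

theorem lift_smul {R S M A : Type} [CommRing R] [CommRing S] [AddCommGroup M] [CommRing A]
    [Module R M] [Algebra S A] (σ : R →+* S) (φ : M →ₛₗ[σ] A) (n : ℕ) (r : R)
    (x : SymmetricPower R (Fin n) M) : lift σ φ n (r • x) = σ r • lift σ φ n x := by
  let : Module R A := Module.compHom _ σ
  induction x using AddCon.induction_on with
  | H x => exact (PiTensorProduct.lift (R := R) (s := fun _ : Fin n => M) _).map_smul r x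

end SymPow

namespace VB

variable {X : Scheme.{0}}

/-! ### The symmetric algebra of a vector space -/

section symmAlg

variable {K : Type} [Field K] {V : Type} [AddCommGroup V] [Module K V]

/-- The symmetric algebra of a vector space, as a polynomial ring. -/
abbrev SV (K V : Type) [Field K] [AddCommGroup V] [Module K V] : Type :=
  MvPolynomial (Module.Basis.ofVectorSpaceIndex K V) K

/-- The linear forms in the symmetric algebra. -/
def symι (K V : Type) [Field K] [AddCommGroup V] [Module K V] : V →ₗ[K] SV K V :=
  (Module.Basis.ofVectorSpace K V).constr K MvPolynomial.X

/-- The algebra homomorphism extending a linear map. -/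
def symLift {A : Type} [CommRing A] [Algebra K A] (f : V →ₗ[K] A) : SV K V →ₐ[K] A :=
  MvPolynomial.aeval fun b => f (Module.Basis.ofVectorSpace K V b)

theorem symLift_ι {A : Type} [CommRing A] [Algebra K A] (f : V →ₗ[K] A) (v : V) :
    symLift f (symι K V v) = f v := by
  have : (symLift f).toLinearMap ∘ₗ symι K V = f := by
    refine (Module.Basis.ofVectorSpace K V).ext fun b => ?_
    rw [LinearMap.comp_apply, symι, Module.Basis.constr_basis]
    exact MvPolynomial.aeval_X _ b
  exact LinearMap.congr_fun this v

/-- A linear left inverse of `Finsupp.linearCombination K v` sends each `v i` to the i-th unit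
vector; its extension to the symmetric algebra undoes the evaluation of polynomials. -/
theorem algebraicIndependent_symι {ι : Type} {v : ι → V} (hv : LinearIndependent K v) :
    Function.Injective (MvPolynomial.aeval (R := K) fun i => symι K V (v i)) := by
  obtain ⟨π, hπ⟩ := (Finsupp.linearCombination K v).exists_leftInverse_of_injective
    (LinearMap.ker_eq_bot.mpr hv)
  let q : V →ₗ[K] MvPolynomial ι K := Finsupp.linearCombination K MvPolynomial.X ∘ₗ π
  have : (symLift q).comp (MvPolynomial.aeval fun i => symι K V (v i)) = AlgHom.id K _ := by
    refine MvPolynomial.algHom_ext fun i => ?_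
    have h := LinearMap.congr_fun hπ (Finsupp.single i 1)
    simp only [LinearMap.comp_apply, Finsupp.linearCombination_single, one_smul,
      LinearMap.id_apply] at h
    simp [symLift_ι, q, h]
  exact Function.LeftInverse.injective (g := symLift q) fun x => AlgHom.congr_fun this x

theorem prod_X_eq_monomial {ι : Type} {n : ℕ} (f : Fin n → ι) :
    ∏ i, (MvPolynomial.X (f i) : MvPolynomial ι K) =
      MvPolynomial.monomial (∑ i, Finsupp.single (f i) 1) 1 := by
  rw [MvPolynomial.monomial_sum_one]
  rfl

end symmAlg

theorem sp_induction {n : ℕ} {M : X.Modules} {U : X.Opens}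
    {C : Sec (VB.symPre n M) U → Prop} (h0 : C 0) (hsp : ∀ (a : Γ(X, U)) m, C (a • sp m))
    (hadd : ∀ s t, C s → C t → C (s + t)) (s : Sec (VB.symPre n M) U) : C s := by
  have hs : s ∈ Submodule.span Γ(X, U) (Set.range sp) := by rw [span_sp]; trivial
  induction hs using Submodule.closure_induction with
  | zero => exact h0
  | add x y _ _ hx hy => exact hadd x y hx hy
  | smul_mem a x hx => obtain ⟨m, rfl⟩ := hx; exact hsp a m

theorem Gen.sym {M : X.Modules} {U : X.Opens} {ι : Type} [Finite ι] {e : ι → Sec M.val U}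
    (he : Gen M.val U e) (n : ℕ) :
    Gen (VB.symPre n M) U (fun f : Fin n → ι => sp fun i => e (f i)) := by
  intro W s y hy hyW
  induction s using sp_induction with
  | h0 => exact ⟨U ⊓ W, inf_le_left, inf_le_right, ⟨hy, hyW⟩, by rw [map_zero]; exact zero_mem _⟩
  | hsp a m =>
    -- There are only `n` factors, so the neighbourhoods on which each becomes a combination of the
    -- `e i` have an open intersection.
    have key : ∃ (W' : X.Opens) (hU : W' ≤ U) (hW : W' ≤ W), y ∈ W' ∧ ∀ i, rs M.val hW (m i) ∈
        Submodule.span Γ(X, W') (Set.range fun i => rs M.val hU (e i)) := by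
      choose W' hU hW hy' h using fun i => he W (m i) y hy hyW
      have hfin : ((U ⊓ W : X.Opens) : Set X) ∩ ⋂ i, (W' i : Set X) ∈ nhds y :=
        Filter.inter_mem ((U ⊓ W).isOpen.mem_nhds ⟨hy, hyW⟩)
          (Filter.iInter_mem.mpr fun i => (W' i).isOpen.mem_nhds (hy' i))
      obtain ⟨O, hO, hOo, hyO⟩ := mem_nhds_iff.mp hfin
      refine ⟨⟨O, hOo⟩, fun x hx => (hO hx).1.1, fun x hx => (hO hx).1.2, hyO, fun i => ?_⟩
      have hOi : (⟨O, hOo⟩ : X.Opens) ≤ W' i := fun x hx => Set.mem_iInter.mp (hO hx).2 i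
      have := rs_mem_span_rs M.val (hU i) hOi e _ (h i)
      rwa [rs_rs] at this
    obtain ⟨W', hU, hW, hy', h⟩ := key
    refine ⟨W', hU, hW, hy', ?_⟩
    rw [rs_smul, rs_sp]
    refine Submodule.smul_mem _ _ ?_
    simp only [rs_sp]
    exact multilinear_mem_span (sp (n := n) (M := M) (U := W')) (fun i => rs M.val hU (e i))
      (fun i => rs M.val hW (m i)) h
  | hadd s t hs ht =>
    obtain ⟨W₁, hU₁, hW₁, hy₁, h₁⟩ := hs
    obtain ⟨W₂, hU₂, hW₂, hy₂, h₂⟩ := ht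
    refine ⟨W₁ ⊓ W₂, inf_le_left.trans hU₁, inf_le_left.trans hW₁, ⟨hy₁, hy₂⟩, ?_⟩
    have h₁' := rs_mem_span_rs _ hU₁ (inf_le_left : W₁ ⊓ W₂ ≤ W₁) _ _ h₁
    have h₂' := rs_mem_span_rs _ hU₂ (inf_le_right : W₁ ⊓ W₂ ≤ W₂) _ _ h₂
    rw [rs_rs] at h₁' h₂'
    rw [map_add]
    exact add_mem h₁' h₂'

/-! ### Realizations of tensor products and symmetric powers -/

section

variable [IsIntegral X] {V : Type} [AddCommGroup V] [Module (FF X) V]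

/-- The value of a section of a presheaf tensor product. -/
def Rlz.tensorVal {P Q : X.PresheafOfModules} (ρ : Rlz P V) (ψ : Rlz Q (FF X)) {U : X.Opens}
    (h : genericPoint X ∈ U) : Sec (VB.tensorPre P Q) U →+ V :=
  TensorProduct.liftAddHom (R := Γ(X, U)) (M := Sec P U) (N := Sec Q U)
    (((smulAddHom (FF X) V).comp (ψ.val U h)).flip.comp (ρ.val U h))
    (fun r p q => by
      change ψ.val U h q • ρ.val U h (r • p) = ψ.val U h (r • q) • ρ.val U h p
      rw [ρ.val_smul, ψ.val_smul, smul_smul, smul_eq_mul, mul_comm])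

theorem Rlz.tensorVal_tm {P Q : X.PresheafOfModules} (ρ : Rlz P V) (ψ : Rlz Q (FF X))
    {U : X.Opens} (h : genericPoint X ∈ U) (p : Sec P U) (q : Sec Q U) :
    ρ.tensorVal ψ h (tm p q) = ψ.val U h q • ρ.val U h p := rfl

/-- The realization of a presheaf tensor product with a presheaf realized in the function field. -/
def Rlz.tensorPre {P Q : X.PresheafOfModules} (ρ : Rlz P V) (ψ : Rlz Q (FF X)) :
    Rlz (tensorPre P Q) V where
  val U h := ρ.tensorVal ψ h
  val_rs {U W} h hW s := by
    induction s using tm_induction with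
    | h0 => rw [map_zero, map_zero, map_zero]
    | htm p q => rw [rs_tm, tensorVal_tm, tensorVal_tm, ψ.val_rs, ρ.val_rs]
    | hadd s t hs ht => rw [map_add, map_add, map_add, hs, ht]
  val_smul {U} h a s := by
    induction s using tm_induction with
    | h0 => rw [smul_zero, map_zero, smul_zero]
    | htm p q =>
      rw [← LinearMap.map_smul, tensorVal_tm, tensorVal_tm, ψ.val_smul, smul_smul, smul_eq_mul]
    | hadd s t hs ht => rw [smul_add, map_add, map_add, smul_add, hs, ht]

/-- The value of a section of a presheaf symmetric power. -/
def Rlz.symVal {M : X.Modules} (ρ : Rlz M.val V) (n : ℕ) {U : X.Opens} (h : genericPoint X ∈ U) :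
    Sec (VB.symPre n M) U →+ SV (FF X) V :=
  SymPow.lift (R := Γ(X, U)) (M := Sec M.val U) (gK h)
    { toFun := fun m => symι (FF X) V (ρ.val U h m)
      map_add' := fun m m' => by rw [map_add, map_add]
      map_smul' := fun a m => by rw [ρ.val_smul, LinearMap.map_smul] } n

theorem Rlz.symVal_sp {M : X.Modules} (ρ : Rlz M.val V) {n : ℕ} {U : X.Opens}
    (h : genericPoint X ∈ U) (m : Fin n → Sec M.val U) :
    ρ.symVal n h (sp m) = ∏ i, symι (FF X) V (ρ.val U h (m i)) :=
  SymPow.lift_tprod (R := Γ(X, U)) (M := Sec M.val U) _ _ n m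

theorem Rlz.symVal_smul {M : X.Modules} (ρ : Rlz M.val V) {n : ℕ} {U : X.Opens}
    (h : genericPoint X ∈ U) (a : Γ(X, U)) (s : Sec (VB.symPre n M) U) :
    ρ.symVal n h (a • s) = gK h a • ρ.symVal n h s := by
  let s' : SymmetricPower Γ(X, U) (Fin n) (Sec M.val U) := s
  exact SymPow.lift_smul (gK h) _ n a s'

/-- The realization of a symmetric power. -/
def Rlz.symPre {M : X.Modules} (ρ : Rlz M.val V) (n : ℕ) : Rlz (symPre n M) (SV (FF X) V) where
  val U h := ρ.symVal n h
  val_rs {U W} h hW s := by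
    induction s using sp_induction with
    | h0 => rw [map_zero, map_zero, map_zero]
    | hsp a m =>
      rw [rs_smul, rs_sp, symVal_smul, symVal_smul, gK_rf, symVal_sp, symVal_sp]
      simp only [ρ.val_rs]
    | hadd s t hs ht => rw [map_add, map_add, map_add, hs, ht]
  val_smul {U} h a s := ρ.symVal_smul h a s

/-- All words in the `e i` generate but repeat under permutation. One word per exponent vector still
generates, and the values are then distinct monomials in algebraically independent elements, hence
linearly independent. -/
theorem Rlz.IsGood.symPre {M : X.Modules} {ρ : Rlz M.val V} (hρ : ρ.IsGood) (n : ℕ) :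
    (ρ.symPre n).IsGood := by
  intro y
  obtain ⟨U, hy, ι, hι, e, he, hli⟩ := hρ y
  let key : (Fin n → ι) → ι →₀ ℕ := fun f => ∑ i, Finsupp.single (f i) 1
  choose f hf using fun d : Set.range key => d.2
  refine ⟨U, hy, Set.range key, inferInstance, fun d => sp fun i => e (f d i), ?_, ?_⟩
  · have hrange : Set.range (fun g : Fin n → ι => sp fun i => e (g i)) ⊆
        Set.range fun d : Set.range key => sp fun i => e (f d i) := by
      rintro _ ⟨g, rfl⟩
      obtain ⟨σ, hσ⟩ := exists_perm_of_sum_single_eq (f ⟨key g, g, rfl⟩) g (hf ⟨key g, g, rfl⟩)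
      refine ⟨⟨key g, g, rfl⟩, ?_⟩
      have h : (fun i => e (f ⟨key g, g, rfl⟩ i)) = fun i => e (g (σ i)) :=
        funext fun i => congrArg e (congrFun hσ i).symm
      exact (congrArg sp h).trans (sp_perm σ fun i => e (g i))
    intro W s z hz hzW
    obtain ⟨W', hU, hW, hz', hs⟩ := he.sym n W s z hz hzW
    refine ⟨W', hU, hW, hz', Submodule.span_mono ?_ hs⟩
    rintro _ ⟨g, rfl⟩
    obtain ⟨d, hd⟩ := hrange ⟨g, rfl⟩
    exact ⟨d, congrArg (rs _ hU) hd⟩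
  · have h1 := ((MvPolynomial.basisMonomials ι (FF X)).linearIndependent.comp
      (Subtype.val : Set.range key → ι →₀ ℕ) Subtype.val_injective).map'
      (MvPolynomial.aeval fun i => symι (FF X) V (ρ.val U (generic_mem hy) (e i))).toLinearMap
      (LinearMap.ker_eq_bot.mpr (algebraicIndependent_symι hli))
    have h2 : (fun d : Set.range key =>
        (ρ.symPre n).val U (generic_mem hy) (sp fun i => e (f d i))) =
        fun d => MvPolynomial.aeval (fun i => symι (FF X) V (ρ.val U (generic_mem hy) (e i)))
          (MvPolynomial.basisMonomials ι (FF X) d.1) := by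
      funext d
      refine (ρ.symVal_sp _ _).trans ?_
      rw [MvPolynomial.coe_basisMonomials, ← hf d]
      change _ = MvPolynomial.aeval _ (MvPolynomial.monomial (∑ i, Finsupp.single (f d i) 1) 1)
      rw [← prod_X_eq_monomial, map_prod]
      simp only [MvPolynomial.aeval_X]
    rw [h2]
    exact h1

/-- `P` has a good realization in `V` with lattices `Λ`. -/
def Realizes (P : X.PresheafOfModules) (Λ : ∀ y : X, Submodule (loc y) V) : Prop :=
  ∃ ρ : Rlz P V, ρ.IsGood ∧ ∀ y, ρ.lat y = Λ y

/-- `P` has a realization in the function field, with local generators of values `c y`. -/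
def RealizesLine (P : X.PresheafOfModules) (c : X → (FF X)ˣ) : Prop :=
  ∃ ρ : Rlz P (FF X), ∀ y, ∃ (U : X.Opens) (hy : y ∈ U) (e : Sec P U),
    Gen P U (fun _ : Unit => e) ∧ ρ.val U (generic_mem hy) e = c y

theorem Realizes.sheafify {P : X.PresheafOfModules} {Λ : ∀ y : X, Submodule (loc y) V}
    (h : Realizes P Λ) : Realizes (sheafify P).val Λ := by
  obtain ⟨ρ, hρ, hΛ⟩ := h
  exact ⟨ρ.sh, hρ.sh, fun y => (ρ.lat_sh y).trans (hΛ y)⟩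

theorem RealizesLine.sheafify {P : X.PresheafOfModules} {c : X → (FF X)ˣ}
    (h : RealizesLine P c) : RealizesLine (VB.sheafify P).val c := by
  obtain ⟨ρ, hρ⟩ := h
  refine ⟨ρ.sh, fun y => ?_⟩
  obtain ⟨U, hy, e, he, hc⟩ := hρ y
  exact ⟨U, hy, toSh P U e, he.sheafify, (ρ.sh_toSh _ e).trans hc⟩

theorem RealizesLine.realizes {P : X.PresheafOfModules} {c : X → (FF X)ˣ}
    (h : RealizesLine P c) : Realizes P fun y => Submodule.span (loc y) {(c y : FF X)} := by
  obtain ⟨ρ, hρ⟩ := h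
  refine ⟨ρ, fun y => ?_, fun y => ?_⟩
  · obtain ⟨U, hy, e, he, hc⟩ := hρ y
    refine ⟨U, hy, Unit, inferInstance, _, he, ?_⟩
    rw [linearIndependent_unique_iff, hc]
    exact (c y).ne_zero
  · obtain ⟨U, hy, e, he, hc⟩ := hρ y
    rw [ρ.lat_eq_span he hy, hc, Set.range_const]

/-- Multiplication of a lattice by a scalar. -/
def scale {y : X} (c : (FF X)ˣ) (Λ : Submodule (loc y) V) : Submodule (loc y) V :=
  Λ.map ((LinearMap.lsmul (FF X) V (c : FF X)).restrictScalars (loc y))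

/-- The image of a lattice. -/
def push {W : Type} [AddCommGroup W] [Module (FF X) W] {y : X} (f : V →ₗ[FF X] W)
    (Λ : Submodule (loc y) V) : Submodule (loc y) W :=
  Λ.map (f.restrictScalars (loc y))

theorem Realizes.tensorPre {P Q : X.PresheafOfModules} {Λ : ∀ y : X, Submodule (loc y) V}
    {c : X → (FF X)ˣ} (h : Realizes P Λ) (h' : RealizesLine Q c) :
    Realizes (tensorPre P Q) fun y => scale (c y) (Λ y) := by
  obtain ⟨ρ, hρ, hΛ⟩ := h
  obtain ⟨ψ, hψ⟩ := h'
  obtain rfl : ρ.lat = Λ := funext hΛ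
  have key : ∀ y, ∃ (U : X.Opens) (hy : y ∈ U) (ι : Type) (_ : Finite ι)
      (e : ι → Sec P U) (f : Sec Q U), Gen P U e ∧ Gen Q U (fun _ : Unit => f) ∧
        LinearIndependent (FF X) (fun i => ρ.val U (generic_mem hy) (e i)) ∧
        ψ.val U (generic_mem hy) f = c y := by
    intro y
    obtain ⟨U, hy, ι, hι, e, he, hli⟩ := hρ y
    obtain ⟨U', hy', f, hf, hc⟩ := hψ y
    refine ⟨U ⊓ U', ⟨hy, hy'⟩, ι, hι, _, _, he.mono inf_le_left, hf.mono inf_le_right, ?_, ?_⟩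
    · simpa only [ρ.val_rs] using hli
    · rw [ψ.val_rs, hc]
  refine ⟨ρ.tensorPre ψ, fun y => ?_, fun y => ?_⟩
  · obtain ⟨U, hy, ι, hι, e, f, he, hf, hli, hc⟩ := key y
    refine ⟨U, hy, ι × Unit, inferInstance, _, he.tensor hf, ?_⟩
    have h1 := (hli.comp (Prod.fst : ι × Unit → ι) (fun a b hab => Prod.ext hab rfl)).units_smul
      (fun _ => c y)
    have h2 : (fun i : ι × Unit => (ρ.tensorPre ψ).val U (generic_mem hy) (tm (e i.1) f)) =
        (fun _ : ι × Unit => c y) •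
          ((fun i => ρ.val U (generic_mem hy) (e i)) ∘ (Prod.fst : ι × Unit → ι)) := by
      funext i
      exact congrArg (· • ρ.val U (generic_mem hy) (e i.1)) hc
    rw [h2]
    exact h1
  · obtain ⟨U, hy, ι, hι, e, f, he, hf, hli, hc⟩ := key y
    beta_reduce
    rw [Rlz.lat_eq_span _ (he.tensor hf) hy, ρ.lat_eq_span he hy, scale, Submodule.map_span,
      ← Set.range_comp]
    congr 1
    ext v
    constructor
    · rintro ⟨⟨i, j⟩, rfl⟩
      exact ⟨i, congrArg (· • ρ.val U (generic_mem hy) (e i)) hc.symm⟩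
    · rintro ⟨i, rfl⟩
      exact ⟨⟨i, ()⟩, congrArg (· • ρ.val U (generic_mem hy) (e i)) hc⟩

/-- Both lattices are spanned by the n-fold products of the values of local generators. -/
theorem Realizes.symPre {M : X.Modules} {Λ : ∀ y : X, Submodule (loc y) V}
    (h : Realizes M.val Λ) (n : ℕ) :
    Realizes (symPre n M) fun y => push (symι (FF X) V) (Λ y) ^ n := by
  obtain ⟨ρ, hρ, hΛ⟩ := h
  obtain rfl : ρ.lat = Λ := funext hΛ
  refine ⟨ρ.symPre n, hρ.symPre n, fun y => ?_⟩
  obtain ⟨U, hy, ι, hι, e, he, hli⟩ := hρ y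
  beta_reduce
  rw [Rlz.lat_eq_span _ (he.sym n) hy, ρ.lat_eq_span he hy, push, Submodule.map_span,
    ← Set.range_comp, Submodule.span_pow]
  congr 1
  ext v
  rw [Set.mem_pow]
  constructor
  · rintro ⟨g, rfl⟩
    refine ⟨fun i => ⟨_, g i, rfl⟩, ?_⟩
    rw [List.prod_ofFn]
    exact (ρ.symVal_sp _ _).symm
  · rintro ⟨g, rfl⟩
    choose k hk using fun i => (g i).2
    refine ⟨k, ?_⟩
    refine (ρ.symVal_sp _ _).trans ?_
    rw [List.prod_ofFn]
    exact Finset.prod_congr rfl fun i _ => hk i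

theorem RealizesLine.tensorPre {P Q : X.PresheafOfModules} {c c' : X → (FF X)ˣ}
    (h : RealizesLine P c) (h' : RealizesLine Q c') : RealizesLine (VB.tensorPre P Q) (c * c') := by
  obtain ⟨ρ, hρ⟩ := h
  obtain ⟨ψ, hψ⟩ := h'
  refine ⟨ρ.tensorPre ψ, fun y => ?_⟩
  obtain ⟨U, hy, e, he, hc⟩ := hρ y
  obtain ⟨U', hy', f, hf, hc'⟩ := hψ y
  refine ⟨U ⊓ U', ⟨hy, hy'⟩, tm (rs P inf_le_left e) (rs Q inf_le_right f), ?_, ?_⟩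
  · intro W s z hz hzW
    obtain ⟨W', hU, hW, hz', hs⟩ :=
      ((he.mono inf_le_left).tensor (hf.mono inf_le_right) : Gen _ (U ⊓ U') _) W s z hz hzW
    refine ⟨W', hU, hW, hz', Submodule.span_mono ?_ hs⟩
    rintro _ ⟨i, rfl⟩
    exact ⟨(), rfl⟩
  · refine (ρ.tensorVal_tm ψ _ _ _).trans ?_
    rw [ρ.val_rs, ψ.val_rs, hc, hc', smul_eq_mul, mul_comm]
    rfl

end

/-! ### Sections as intersections of lattices -/

theorem sec_ext (M : X.Modules) {U : X.Opens} (s t : Sec M.val U)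
    (h : ∀ y ∈ U, ∃ (W : X.Opens) (hW : W ≤ U), y ∈ W ∧ rs M.val hW s = rs M.val hW t) : s = t := by
  choose W hW hyW hst using h
  refine TopCat.Sheaf.eq_of_locally_eq' (⟨M.presheaf, M.isSheaf⟩ : TopCat.Sheaf Ab X)
    (fun y : U => W y.1 y.2) U (fun y => homOfLE (hW y.1 y.2)) ?_ s t fun y => hst y.1 y.2
  intro y hy
  exact Opens.mem_iSup.mpr ⟨⟨y, hy⟩, hyW y hy⟩

theorem sec_glue (M : X.Modules) (U : X.Opens) (W : U → X.Opens) (hW : ∀ y, W y ≤ U)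
    (hyW : ∀ y, y.1 ∈ W y) (t : ∀ y, Sec M.val (W y))
    (h : ∀ y z, rs M.val (inf_le_left : W y ⊓ W z ≤ W y) (t y) = rs M.val inf_le_right (t z)) :
    ∃ s : Sec M.val U, ∀ y, rs M.val (hW y) s = t y := by
  obtain ⟨s, hs, -⟩ := TopCat.Sheaf.existsUnique_gluing'
    (⟨M.presheaf, M.isSheaf⟩ : TopCat.Sheaf Ab X) W U (fun y => homOfLE (hW y))
    (fun y hy => Opens.mem_iSup.mpr ⟨⟨y, hy⟩, hyW _⟩) t (fun y z => h y z)
  exact ⟨s, hs⟩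

/-- Covers empty open sets, which miss the generic point and so carry no values. -/
theorem sec_subsingleton (M : X.Modules) {U : X.Opens} (hU : ∀ y, y ∉ U) (s t : Sec M.val U) :
    s = t := sec_ext M s t fun y hy => (hU y hy).elim

section

variable [IsIntegral X] {V : Type} [AddCommGroup V] [Module (FF X) V]

/-- Locally a section is a combination of generators with independent values. If its value is zero,
its coefficients vanish at the generic point, hence vanish, since X is integral. -/
theorem Rlz.val_injective {M : X.Modules} (ρ : Rlz M.val V) (hρ : ρ.IsGood) {U : X.Opens}
    (h : genericPoint X ∈ U) : Function.Injective (ρ.val U h) := by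
  rw [injective_iff_map_eq_zero]
  intro s hs
  refine sec_ext M _ _ fun y hy => ?_
  obtain ⟨U', hy', ι, hι, e, he, hli⟩ := hρ y
  obtain ⟨W', hU', hW', hyW', hspan⟩ := he U s y hy' hy
  have := Fintype.ofFinite ι
  refine ⟨W', hW', hyW', ?_⟩
  rw [map_zero]
  obtain ⟨a, ha⟩ := (Submodule.mem_span_range_iff_exists_fun _).mp hspan
  have h0 : ∑ i, gK (generic_mem hyW') (a i) • ρ.val U' (generic_mem hy') (e i) = 0 := by
    rw [← hs, ← ρ.val_rs hW' (generic_mem hyW'), ← ha, map_sum]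
    refine Finset.sum_congr rfl fun i _ => ?_
    rw [ρ.val_smul, ρ.val_rs]
  have h1 := Fintype.linearIndependent_iff.mp hli _ h0
  rw [← ha]
  refine Finset.sum_eq_zero fun i _ => ?_
  rw [(map_eq_zero_iff _ (gK_injective _)).mp (h1 i), zero_smul]

/-- The local sections with value `v` agree on nonempty overlaps, which contain the generic point,
by `val_injective`; so they glue. -/
theorem Rlz.exists_val_eq {M : X.Modules} (ρ : Rlz M.val V) (hρ : ρ.IsGood) {U : X.Opens}
    (h : genericPoint X ∈ U) (v : V) (hv : ∀ y ∈ U, v ∈ ρ.lat y) :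
    ∃ s, ρ.val U h s = v := by
  have key : ∀ y : U, ∃ (W : X.Opens) (hW : W ≤ U) (hy : y.1 ∈ W) (t : Sec M.val W),
      ρ.val W (generic_mem hy) t = v := by
    rintro ⟨y, hy⟩
    obtain ⟨W, hyW, t, ht⟩ := ρ.mem_lat.mp (hv y hy)
    exact ⟨W ⊓ U, inf_le_right, ⟨hyW, hy⟩, rs M.val inf_le_left t, by rw [ρ.val_rs, ht]⟩
  choose W hW hyW t ht using key
  obtain ⟨s, hs⟩ := sec_glue M U W hW hyW t fun y z => by
    by_cases hne : ∃ x, x ∈ W y ⊓ W z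
    · obtain ⟨x, hx⟩ := hne
      refine ρ.val_injective hρ (generic_mem hx) ?_
      rw [ρ.val_rs, ρ.val_rs, ht, ht]
    · exact sec_subsingleton M (not_exists.mp hne) _ _
  refine ⟨s, ?_⟩
  rw [← ht ⟨_, h⟩, ← hs, ρ.val_rs]

/-- The tautological realization of the structure sheaf. -/
def unitRlz (X : Scheme.{0}) [IsIntegral X] : Rlz (structureSheaf X).val (FF X) where
  val U h := (gK h : Γ(X, U) →+* FF X).toAddMonoidHom
  val_rs h hW s := gK_rf hW h s
  val_smul h a s := (gK h).map_mul a s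

theorem unitRlz_line (y : X) : ∃ (U : X.Opens) (hy : y ∈ U) (e : Sec (structureSheaf X).val U),
    Gen (structureSheaf X).val U (fun _ : Unit => e) ∧
      (unitRlz X).val U (generic_mem hy) e = (1 : (FF X)ˣ) := by
  refine ⟨⊤, trivial, (1 : Γ(X, ⊤)), ?_, (gK _).map_one⟩
  intro W s z hz hzW
  refine ⟨W, le_top, le_rfl, hzW, ?_⟩
  rw [rs_refl, Set.range_const, Submodule.mem_span_singleton]
  refine ⟨s, ?_⟩
  have h1 : rf (le_top : W ≤ ⊤) (1 : Γ(X, ⊤)) = 1 := map_one _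
  exact (congrArg (fun a : Γ(X, W) => (show Γ(X, W) from s) * a) h1).trans
    (mul_one (show Γ(X, W) from s))

theorem realizesLine_unit : RealizesLine (structureSheaf X).val (1 : X → (FF X)ˣ) :=
  ⟨unitRlz X, unitRlz_line⟩

end

/-! ### Duals of line bundles -/

/-- The presheaf dual. -/
def dualPre (M : X.Modules) : X.PresheafOfModules :=
  PresheafOfModules.ofPresheaf (dualPresheafAb M) (dualPresheafAb_map_smul M)

/-- Evaluation of a section of the dual on a section over a smaller open set. -/
def dev {M : X.Modules} {U : X.Opens} (φ : Sec (dualPre M) U) {W : X.Opens} (h : W ≤ U) :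
    Sec M.val W →ₗ[Γ(X, W)] Γ(X, W) :=
  Subtype.val (p := fun x => x ∈ dualSections M U) φ ⟨W, h⟩

theorem dev_rs {M : X.Modules} {U : X.Opens} (φ : Sec (dualPre M) U) {W W' : X.Opens} (h : W ≤ U)
    (h' : W' ≤ W) (s : Sec M.val W) :
    dev φ (h'.trans h) (rs M.val h' s) = rf h' (dev φ h s) :=
  Subtype.property (p := fun x => x ∈ dualSections M U) φ W W' h h' s

theorem rs_dev {M : X.Modules} {U : X.Opens} (φ : Sec (dualPre M) U) {W W' : X.Opens} (h : W ≤ U)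
    (h' : W' ≤ W) : dev (rs (dualPre M) h φ) h' = dev φ (h'.trans h) := rfl

theorem dev_add {M : X.Modules} {U : X.Opens} (φ ψ : Sec (dualPre M) U) {W : X.Opens} (h : W ≤ U) :
    dev (φ + ψ) h = dev φ h + dev ψ h := rfl

theorem dev_zero {M : X.Modules} {U : X.Opens} {W : X.Opens} (h : W ≤ U) :
    dev (0 : Sec (dualPre M) U) h = 0 := rfl

theorem dev_smul {M : X.Modules} {U : X.Opens} (a : Γ(X, U)) (φ : Sec (dualPre M) U)
    {W : X.Opens} (h : W ≤ U) : dev (a • φ) h = rf h a • dev φ h := rfl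

theorem dual_ext {M : X.Modules} {U : X.Opens} {φ ψ : Sec (dualPre M) U}
    (h : ∀ (W : X.Opens) (hW : W ≤ U) (s : Sec M.val W), dev φ hW s = dev ψ hW s) : φ = ψ :=
  Subtype.ext (p := fun x => x ∈ dualSections M U)
    (funext fun W => LinearMap.ext fun s => h W.1 W.2 s)

/-- A section of the dual, given by a compatible family. -/
def dmk {M : X.Modules} {U : X.Opens} (φ : ∀ W : X.Opens, W ≤ U → Sec M.val W →ₗ[Γ(X, W)] Γ(X, W))
    (h : ∀ (W W' : X.Opens) (hW : W ≤ U) (h' : W' ≤ W) (s : Sec M.val W),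
      φ W' (h'.trans hW) (rs M.val h' s) = rf h' (φ W hW s)) : Sec (dualPre M) U :=
  (⟨fun W => φ W.1 W.2, h⟩ : dualSections M U)

theorem fun_subsingleton {U : X.Opens} (hU : ∀ y, y ∉ U) (a b : Γ(X, U)) : a = b :=
  sec_subsingleton (structureSheaf X) hU a b

section

variable [IsIntegral X]

theorem Rlz.isGood_of_line {P : X.PresheafOfModules} {ρ : Rlz P (FF X)} {c : X → (FF X)ˣ}
    (hρ : ∀ y, ∃ (U : X.Opens) (hy : y ∈ U) (e : Sec P U),
      Gen P U (fun _ : Unit => e) ∧ ρ.val U (generic_mem hy) e = c y) : ρ.IsGood := by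
  intro y
  obtain ⟨U, hy, e, he, hc⟩ := hρ y
  refine ⟨U, hy, Unit, inferInstance, _, he, ?_⟩
  rw [linearIndependent_unique_iff, hc]
  exact (c y).ne_zero

theorem exists_fun {U : X.Opens} (h : genericPoint X ∈ U) (c : FF X) (hc : ∀ y ∈ U, c ∈ loc y) :
    ∃ a : Γ(X, U), gK h a = c := by
  refine (unitRlz X).exists_val_eq (Rlz.isGood_of_line (c := 1) unitRlz_line) h c fun y hy =>
    (unitRlz X).mem_lat.mpr ?_
  obtain ⟨W, hW, a, ha⟩ := mem_loc.mp (hc y hy)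
  exact ⟨W, hW, a, ha⟩

theorem mem_loc_of_gen {M : X.Modules} (ρ : Rlz M.val (FF X)) {U : X.Opens} {e : Sec M.val U}
    (he : Gen M.val U fun _ : Unit => e) {y : X} (hy : y ∈ U) {W : X.Opens} (hW : y ∈ W)
    (s : Sec M.val W) :
    ∃ a ∈ loc y, ρ.val W (generic_mem hW) s = a * ρ.val U (generic_mem hy) e := by
  have h : ρ.val W (generic_mem hW) s ∈ ρ.lat y := ρ.mem_lat.mpr ⟨W, hW, s, rfl⟩
  rw [ρ.lat_eq_span he hy, Set.range_const, Submodule.mem_span_singleton] at h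
  obtain ⟨a, ha⟩ := h
  exact ⟨a, a.2, ha.symm⟩

/-- A generator of nonzero value is a basis over every smaller open set. -/
theorem Rlz.bijective_smul {M : X.Modules} {ρ : Rlz M.val (FF X)} (hρ : ρ.IsGood) {U : X.Opens}
    {e : Sec M.val U} (he : Gen M.val U fun _ : Unit => e) (h : genericPoint X ∈ U)
    (hc : ρ.val U h e ≠ 0) {W : X.Opens} (hW : W ≤ U) :
    Function.Bijective (LinearMap.toSpanSingleton Γ(X, W) (Sec M.val W) (rs M.val hW e)) := by
  by_cases hne : ∃ x, x ∈ W
  · obtain ⟨x, hx⟩ := hne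
    constructor
    · rw [injective_iff_map_eq_zero]
      intro a ha
      have h1 := congrArg (ρ.val W (generic_mem hx)) ha
      rw [LinearMap.toSpanSingleton_apply, ρ.val_smul, ρ.val_rs, map_zero, smul_eq_mul,
        mul_eq_zero, or_iff_left hc] at h1
      exact (map_eq_zero_iff _ (gK_injective _)).mp h1
    · intro s
      obtain ⟨a, ha⟩ := exists_fun (generic_mem hx) (ρ.val W (generic_mem hx) s / ρ.val U h e) (by
        intro y hy
        obtain ⟨a, ha, hs⟩ := mem_loc_of_gen ρ he (hW hy) hy s
        rw [hs, mul_div_cancel_right₀ _ hc]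
        exact ha)
      refine ⟨a, ρ.val_injective hρ (generic_mem hx) ?_⟩
      rw [LinearMap.toSpanSingleton_apply, ρ.val_smul, ρ.val_rs, ha, smul_eq_mul,
        div_mul_cancel₀ _ hc]
  · have h' := not_exists.mp hne
    exact ⟨fun a b _ => fun_subsingleton h' a b, fun s => ⟨0, sec_subsingleton M h' _ _⟩⟩

/-- The dual generator. -/
theorem exists_dual_gen {M : X.Modules} {ρ : Rlz M.val (FF X)} (hρ : ρ.IsGood) {U : X.Opens}
    {e : Sec M.val U} (he : Gen M.val U fun _ : Unit => e) (h : genericPoint X ∈ U)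
    (hc : ρ.val U h e ≠ 0) :
    ∃ φ : Sec (dualPre M) U, (∀ (W : X.Opens) (hW : W ≤ U), dev φ hW (rs M.val hW e) = 1) ∧
      Gen (dualPre M) U fun _ : Unit => φ := by
  let b : ∀ W : X.Opens, W ≤ U → (Γ(X, W) ≃ₗ[Γ(X, W)] Sec M.val W) := fun W hW =>
    LinearEquiv.ofBijective _ (Rlz.bijective_smul hρ he h hc hW)
  have hb : ∀ (W : X.Opens) (hW : W ≤ U) (a : Γ(X, W)), b W hW a = a • rs M.val hW e :=
    fun W hW a => rfl
  have hb' : ∀ (W : X.Opens) (hW : W ≤ U) (s : Sec M.val W),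
      (b W hW).symm s • rs M.val hW e = s := fun W hW s => (b W hW).apply_symm_apply s
  let φ : Sec (dualPre M) U := dmk (fun W hW => (b W hW).symm.toLinearMap) (by
    intro W W' hW h' s
    refine (LinearEquiv.symm_apply_eq _).mpr ?_
    rw [hb]
    conv_lhs => rw [← hb' W hW s]
    rw [rs_smul, rs_rs]
    rfl)
  have hφ : ∀ (W : X.Opens) (hW : W ≤ U), dev φ hW (rs M.val hW e) = 1 := by
    intro W hW
    refine (LinearEquiv.symm_apply_eq _).mpr ?_
    rw [hb, one_smul]
  -- Any ψ equals ψ(e) • φ on the common open set, because both sides agree on the basis `e`.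
  refine ⟨φ, hφ, fun W ψ y hy hyW => ⟨U ⊓ W, inf_le_left, inf_le_right, ⟨hy, hyW⟩, ?_⟩⟩
  rw [Set.range_const, Submodule.mem_span_singleton]
  refine ⟨dev ψ inf_le_right (rs M.val inf_le_left e), dual_ext fun O hO s => ?_⟩
  rw [dev_smul, rs_dev, rs_dev, ← hb' O (hO.trans inf_le_left) s, map_smul, map_smul,
    LinearMap.smul_apply, hφ, ← dev_rs, rs_rs]
  rw [smul_eq_mul, smul_eq_mul, smul_eq_mul, mul_one, mul_comm]

/-- At the generic point a functional is multiplication by some d ∈ K, and d = φ(e₀)/c₀ is read off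
from one fixed section `e₀` of value c₀. The functional dual to a generator of value `c y` has d =
(c y)⁻¹. -/
theorem RealizesLine.dualPre {M : X.Modules} {c : X → (FF X)ˣ} (h : RealizesLine M.val c) :
    RealizesLine (dualPre M) c⁻¹ := by
  obtain ⟨ρ, hρ⟩ := h
  have hgood := Rlz.isGood_of_line hρ
  obtain ⟨U₀, hη, e₀, he₀, hc₀⟩ := hρ (genericPoint X)
  set c₀ := c (genericPoint X) with hc₀_def
  have hm : ∀ {U : X.Opens}, genericPoint X ∈ U → genericPoint X ∈ U ⊓ U₀ := fun h => ⟨h, hη⟩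
  let ψ : Rlz (VB.dualPre M) (FF X) :=
    { val := fun U h =>
        { toFun := fun φ => (c₀⁻¹ : (FF X)ˣ) *
            gK (U := U ⊓ U₀) (hm h) (dev φ inf_le_left (rs M.val inf_le_right e₀))
          map_zero' := by rw [dev_zero, LinearMap.zero_apply, map_zero, mul_zero]
          map_add' := fun φ φ' => by rw [dev_add, LinearMap.add_apply, map_add, mul_add] }
      val_rs := by
        intro U W h hW φ
        change _ * gK _ (dev (rs _ _ _) _ _) = _ * gK _ (dev _ _ _)
        rw [rs_dev, ← gK_rf (U := U ⊓ U₀) (V := W ⊓ U₀) (hm hW) (inf_le_inf_right _ h), ← dev_rs,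
          rs_rs]
      val_smul := by
        intro U h a φ
        change _ * gK _ (dev (a • φ) _ _) = gK _ a * (_ * gK _ (dev _ _ _))
        rw [dev_smul, LinearMap.smul_apply, smul_eq_mul, map_mul, gK_rf, mul_left_comm] }
  refine ⟨ψ, fun y => ?_⟩
  obtain ⟨U, hy, e, he, hc⟩ := hρ y
  obtain ⟨φ, hφ, hgen⟩ := exists_dual_gen hgood he (generic_mem hy)
    (by rw [hc]; exact (c y).ne_zero)
  refine ⟨U, hy, φ, hgen, ?_⟩
  change (c₀⁻¹ : (FF X)ˣ) * gK (U := U ⊓ U₀) (hm (generic_mem hy)) _ = _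
  obtain ⟨a, ha⟩ := (Rlz.bijective_smul hgood he (generic_mem hy)
    (by rw [hc]; exact (c y).ne_zero) (inf_le_left : U ⊓ U₀ ≤ U)).2 (rs M.val inf_le_right e₀)
  rw [LinearMap.toSpanSingleton_apply] at ha
  have h1 := congrArg (ρ.val (U ⊓ U₀) (hm (generic_mem hy))) ha
  rw [ρ.val_smul, ρ.val_rs, ρ.val_rs, hc, hc₀, smul_eq_mul] at h1
  rw [← ha, map_smul, hφ, smul_eq_mul, mul_one]
  have h2 : gK (U := U ⊓ U₀) (hm (generic_mem hy)) a = c₀ * ((c y)⁻¹ : (FF X)ˣ) := by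
    rw [← h1, Units.mul_inv_cancel_right]
  rw [h2, Units.inv_mul_cancel_left]
  rfl

end

end VB

/-! ### Coordinates on locally free sheaves -/

section freeCoord

open Limits
universe u v₁ u₁
variable {C : Type u₁} [Category.{v₁} C] {J : GrothendieckTopology C} {R : Sheaf J RingCat.{u}}

namespace SheafOfModules

theorem sum_val_app {M N : SheafOfModules.{u} R} {I : Type*} (S : Finset I)
    (φ : I → (M ⟶ N)) (Y : Cᵒᵖ)
    (s : M.val.obj Y) : (∑ i ∈ S, φ i).val.app Y s = ∑ i ∈ S, (φ i).val.app Y s := by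
  classical
  induction S using Finset.induction_on with
  | empty => rw [Finset.sum_empty, Finset.sum_empty]; rfl
  | insert i S hi ih => rw [Finset.sum_insert hi, Finset.sum_insert hi, ← ih]; rfl

variable [HasSheafify J AddCommGrpCat.{u}] [J.WEqualsLocallyBijective AddCommGrpCat.{u}]

/-- On a finite free module the projections `p i` are dual to the inclusions and the sum of `p i ≫
ιFree i` is the identity; both relations are transported along the isomorphism `G.π`. -/
theorem exists_coord {M : SheafOfModules.{u} R} (G : M.GeneratingSections) [IsIso G.π]
    [Fintype G.I] [DecidableEq G.I] : ∃ f : G.I → (M ⟶ unit R),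
      (∀ (Y : Cᵒᵖ) (s : M.val.obj Y),
        s = ∑ i, (show R.obj.obj Y from (f i).val.app Y s) •
          PresheafOfModules.sections.eval (G.s i) Y) ∧
      ∀ (Y : Cᵒᵖ) (i j : G.I), (f i).val.app Y ((G.s j).val Y) =
        (show R.obj.obj Y from if i = j then 1 else 0) := by
  let p : ∀ i, free (R := R) G.I ⟶ unit R := fun i =>
    Cofan.IsColimit.desc (isColimitFreeCofan G.I) (fun j => if i = j then 𝟙 _ else 0)
  have hp : ∀ i j, ιFree j ≫ p i = if i = j then 𝟙 _ else 0 := fun i j =>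
    Cofan.IsColimit.fac (isColimitFreeCofan G.I) _ j
  have hid : 𝟙 (free (R := R) G.I) = ∑ i, p i ≫ ιFree i := by
    refine Cofan.IsColimit.hom_ext (isColimitFreeCofan G.I) _ _ fun j => ?_
    change ιFree j ≫ _ = ιFree j ≫ _
    rw [Preadditive.comp_sum]
    simp only [← Category.assoc, hp]
    rw [Finset.sum_eq_single j]
    · simp
    · intro i _ hij; simp [hij]
    · simp
  have hG : ∀ i, ιFree i ≫ G.π = M.unitHomEquiv.symm (G.s i) := fun i => by
    rw [← unitHomEquiv_symm_freeHomEquiv_apply, Equiv.apply_symm_apply]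
  refine ⟨fun i => inv G.π ≫ p i, fun Y s => ?_, fun Y i j => ?_⟩
  · have h : 𝟙 M = ∑ i, (inv G.π ≫ p i) ≫ M.unitHomEquiv.symm (G.s i) := by
      simp only [← hG, Category.assoc]
      rw [← Preadditive.comp_sum]
      simp only [← Category.assoc]
      rw [← Preadditive.sum_comp, ← hid]
      simp
    have h2 := congrArg (fun φ : M ⟶ M => φ.val.app Y s) h
    exact h2.trans (sum_val_app _ _ _ _)
  · have h : M.unitHomEquiv.symm (G.s j) ≫ inv G.π ≫ p i = if i = j then 𝟙 _ else 0 := by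
      rw [← hG, ← hp]
      simp
    have h1 : (M.unitHomEquiv.symm (G.s j)).val.app Y (1 : R.obj.obj Y) = (G.s j).val Y :=
      one_smul _ _
    rw [← h1]
    have h2 := congrArg (fun φ : unit R ⟶ unit R => φ.val.app Y (1 : R.obj.obj Y)) h
    refine h2.trans ?_
    split_ifs <;> rfl

end SheafOfModules

end freeCoord

namespace VB

variable {X : Scheme.{0}}

theorem exists_local_coord {E : X.Modules} {r : ℕ} (hE : IsLocallyFreeOfRank E r) (y : X) :
    ∃ (U : X.Opens) (_ : y ∈ U) (e : Fin r → Sec E.val U)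
      (x : ∀ W : X.Opens, W ≤ U → Fin r → Sec E.val W →ₗ[Γ(X, W)] Γ(X, W)),
      (∀ (W : X.Opens) (hW : W ≤ U) (s : Sec E.val W), s = ∑ i, x W hW i s • rs E.val hW (e i)) ∧
      ∀ (W : X.Opens) (hW : W ≤ U) (i j : Fin r),
        x W hW i (rs E.val hW (e j)) = if i = j then 1 else 0 := by
  classical
  obtain ⟨q, hq, hr⟩ := hE
  obtain ⟨U, f, ⟨i, ⟨g⟩⟩, hy⟩ := q.coversTop ⊤ y trivial
  have hyU : y ∈ q.X i := leOfHom g hy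
  obtain ⟨ε⟩ := hr i
  have : Fintype (q.generators i).I := Fintype.ofEquiv _ ε.symm
  have hiso := hq.isIso i
  obtain ⟨f, hf, hf'⟩ := SheafOfModules.exists_coord (q.generators i)
  have hres : ∀ (W : X.Opens) (hW : W ≤ q.X i) (j : (q.generators i).I),
      rs E.val hW (((q.generators i).s j).val (op (Over.mk (𝟙 (q.X i))))) =
        ((q.generators i).s j).val (op (Over.mk (homOfLE hW))) := fun W hW j =>
    ((q.generators i).s j).property
      (Over.homMk (homOfLE hW) : Over.mk (homOfLE hW) ⟶ Over.mk (𝟙 (q.X i))).op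
  refine ⟨q.X i, hyU, fun j => ((q.generators i).s (ε.symm j)).val (op (Over.mk (𝟙 (q.X i)))),
    fun W hW j => ((f (ε.symm j)).val.app (op (Over.mk (homOfLE hW)))).hom, ?_, ?_⟩
  · intro W hW s
    refine (hf (op (Over.mk (homOfLE hW))) s).trans ?_
    refine (Equiv.sum_comp ε.symm _).symm.trans (Finset.sum_congr rfl fun k _ => ?_)
    exact congrArg (fun t => _ • t) (hres W hW (ε.symm k)).symm
  · intro W hW j k
    refine (congrArg ((f (ε.symm j)).val.app (op (Over.mk (homOfLE hW)))).hom
      (hres W hW (ε.symm k))).trans ?_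
    refine (hf' (op (Over.mk (homOfLE hW))) (ε.symm j) (ε.symm k)).trans ?_
    simp only [EmbeddingLike.apply_eq_iff_eq]
    rfl

section

variable [IsIntegral X]

/-- The realization of a sheaf by coordinates over an open set. -/
theorem exists_realizes_of_isLocallyFree {E : X.Modules} {r : ℕ} (hE : IsLocallyFreeOfRank E r) :
    ∃ ρ : Rlz E.val (Fin r → FF X), ∀ y, ∃ (U : X.Opens) (hy : y ∈ U) (e : Fin r → Sec E.val U),
      Gen E.val U e ∧ LinearIndependent (FF X) fun i => ρ.val U (generic_mem hy) (e i) := by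
  obtain ⟨U₀, hη, e₀, x₀, hx₀, hδ₀⟩ := exists_local_coord hE (genericPoint X)
  have hm : ∀ {U : X.Opens}, genericPoint X ∈ U → genericPoint X ∈ U ⊓ U₀ := fun h => ⟨h, hη⟩
  -- The coordinate maps come separately for each open set; compatibility with restriction follows
  -- by expanding `s` in the basis and using the dual basis relations `hδ₀`.
  have hnat : ∀ (W W' : X.Opens) (hW : W ≤ U₀) (h : W' ≤ W) (i : Fin r) (s : Sec E.val W),
      x₀ W' (h.trans hW) i (rs E.val h s) = rf h (x₀ W hW i s) := by
    intro W W' hW h i s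
    conv_lhs => rw [hx₀ W hW s, map_sum, map_sum]
    rw [Finset.sum_eq_single i]
    · rw [rs_smul, rs_rs, map_smul, hδ₀, if_pos rfl, smul_eq_mul, mul_one]
    · intro j _ hj
      rw [rs_smul, rs_rs, map_smul, hδ₀, if_neg hj.symm, smul_zero]
    · intro h; exact (h (Finset.mem_univ i)).elim
  let ρ : Rlz E.val (Fin r → FF X) :=
    { val := fun U h =>
        { toFun := fun s i => gK (hm h) (x₀ (U ⊓ U₀) inf_le_right i (rs E.val inf_le_left s))
          map_zero' := by funext i; rw [map_zero, map_zero, map_zero]; rfl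
          map_add' := fun s t => by funext i; rw [map_add, map_add, map_add]; rfl }
      val_rs := by
        intro U W h hW s
        funext i
        change gK (hm hW) (x₀ _ _ i (rs _ _ (rs _ _ s))) = gK (hm (h hW)) _
        rw [← gK_rf (hm hW) (inf_le_inf_right U₀ h), ← hnat, rs_rs, rs_rs]
      val_smul := by
        intro U h a s
        funext i
        change gK (hm h) (x₀ _ _ i (rs _ _ (a • s))) = gK h a * gK (hm h) _
        rw [rs_smul, map_smul, smul_eq_mul, map_mul, gK_rf] }
  refine ⟨ρ, fun y => ?_⟩
  obtain ⟨U, hy, e, x, hx, -⟩ := exists_local_coord hE y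
  refine ⟨U, hy, e, ?_, ?_⟩
  · intro W s z hz hzW
    refine ⟨U ⊓ W, inf_le_left, inf_le_right, ⟨hz, hzW⟩, ?_⟩
    rw [hx _ inf_le_left (rs E.val inf_le_right s)]
    exact Submodule.sum_mem _ fun i _ => Submodule.smul_mem _ _ (Submodule.subset_span ⟨i, rfl⟩)
  · have hηU := hm (generic_mem hy)
    -- It suffices that the r values span. Over `U ⊓ U₀` the `e₀ k`, whose values form the standard
    -- basis, are combinations of the `e i`.
    refine linearIndependent_of_top_le_span_of_card_eq_finrank ?_ (by simp)
    rw [← (Pi.basisFun (FF X) (Fin r)).span_eq, Submodule.span_le]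
    rintro _ ⟨k, rfl⟩
    have h1 : ρ.val (U ⊓ U₀) hηU (rs E.val inf_le_right (e₀ k)) = Pi.basisFun (FF X) (Fin r) k := by
      funext i
      change gK _ (x₀ _ _ i (rs _ _ (rs _ _ _))) = _
      rw [rs_rs, hδ₀, Pi.basisFun_apply, Pi.single_apply]
      split_ifs <;> simp
    rw [← h1, hx _ inf_le_left (rs E.val inf_le_right (e₀ k)), map_sum]
    refine Submodule.sum_mem _ fun i _ => ?_
    rw [ρ.val_smul, ρ.val_rs]
    exact Submodule.smul_mem _ _ (Submodule.subset_span ⟨i, rfl⟩)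

theorem exists_realizes {E : X.Modules} {r : ℕ} (hE : IsLocallyFreeOfRank E r) :
    ∃ Λ : ∀ y : X, Submodule (loc y) (Fin r → FF X), Realizes E.val Λ := by
  obtain ⟨ρ, hρ⟩ := exists_realizes_of_isLocallyFree hE
  refine ⟨ρ.lat, ρ, fun y => ?_, fun y => rfl⟩
  obtain ⟨U, hy, e, he, hli⟩ := hρ y
  exact ⟨U, hy, Fin r, inferInstance, e, he, hli⟩

theorem exists_realizesLine {L : X.Modules} (hL : IsLineBundle L) :
    ∃ c : X → (FF X)ˣ, RealizesLine L.val c := by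
  obtain ⟨ρ, hρ⟩ := exists_realizes_of_isLocallyFree hL
  choose U hy e he hli using hρ
  have hne : ∀ y, ρ.val (U y) (generic_mem (hy y)) (e y 0) 0 ≠ 0 := by
    intro y h0
    refine (hli y).ne_zero 0 ?_
    funext i
    rw [Subsingleton.elim i 0]
    exact h0
  refine ⟨fun y => Units.mk0 _ (hne y), ρ.comp (LinearMap.proj 0), fun y =>
    ⟨U y, hy y, e y 0, ?_, rfl⟩⟩
  intro W s z hz hzW
  obtain ⟨W', hU, hW, hz', hs⟩ := he y W s z hz hzW
  refine ⟨W', hU, hW, hz', Submodule.span_mono ?_ hs⟩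
  rintro _ ⟨i, rfl⟩
  exact ⟨(), by rw [Subsingleton.elim i 0]⟩

end

end VB

/-! ### Stalks, base loci and lattices -/

/-- Moves generation of a stalk by germs into the ambient K-vector space, with the local ring
replaced by its image in K. -/
theorem span_eq_top_iff_of_semilinear {R T K V : Type} [CommRing R] [AddCommGroup T] [Module R T]
    [Field K] [AddCommGroup V] [Module K V] (ψ : R →+* K) (φ : T →+ V)
    (hφ : ∀ a t, φ (a • t) = ψ a • φ t) (hinj : Function.Injective φ) (G : Set T) :
    Submodule.span R G = ⊤ ↔ ∀ t, φ t ∈ Submodule.span ψ.range (φ '' G) := by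
  constructor
  · intro h t
    have ht : t ∈ Submodule.span R G := by rw [h]; trivial
    induction ht using Submodule.span_induction with
    | mem t ht => exact Submodule.subset_span ⟨t, ht, rfl⟩
    | zero => rw [map_zero]; exact Submodule.zero_mem _
    | add x y _ _ hx hy => rw [map_add]; exact Submodule.add_mem _ hx hy
    | smul a x _ hx =>
      rw [hφ]
      exact Submodule.smul_mem _ (⟨_, a, rfl⟩ : ψ.range) hx
  · intro h
    refine eq_top_iff.mpr fun t _ => ?_
    have key : ∀ v ∈ Submodule.span ψ.range (φ '' G), ∃ t ∈ Submodule.span R G, φ t = v := by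
      intro v hv
      induction hv using Submodule.span_induction with
      | mem v hv =>
        obtain ⟨t, ht, rfl⟩ := hv
        exact ⟨t, Submodule.subset_span ht, rfl⟩
      | zero => exact ⟨0, Submodule.zero_mem _, map_zero _⟩
      | add v w _ _ hv hw =>
        obtain ⟨s, hs, rfl⟩ := hv
        obtain ⟨t, ht, rfl⟩ := hw
        exact ⟨s + t, Submodule.add_mem _ hs ht, map_add _ _ _⟩
      | smul a v _ hv =>
        obtain ⟨s, hs, rfl⟩ := hv
        obtain ⟨c, b, rfl⟩ := a
        exact ⟨b • s, Submodule.smul_mem _ _ hs, hφ b s⟩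
    obtain ⟨t', ht', heq⟩ := key _ (h t)
    rwa [← hinj heq]

namespace VB

variable {X : Scheme.{0}}

/-- The stalk of a sheaf of modules. -/
abbrev Stk (M : X.Modules) (y : X) : Type := (TopCat.Presheaf.stalk M.presheaf y :)

/-- The germ of a section at a point. -/
def gm (M : X.Modules) {U : X.Opens} {y : X} (hy : y ∈ U) : Sec M.val U →+ Stk M y :=
  (TopCat.Presheaf.germ M.presheaf U y hy).hom

theorem gm_rs (M : X.Modules) {U W : X.Opens} {y : X} (hy : y ∈ W) (h : W ≤ U) (s : Sec M.val U) :
    gm M hy (rs M.val h s) = gm M (h hy) s :=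
  TopCat.Presheaf.germ_res_apply M.presheaf (homOfLE h) y hy s

theorem gm_smul (M : X.Modules) {U : X.Opens} {y : X} (hy : y ∈ U) (a : Γ(X, U))
    (s : Sec M.val U) : gm M hy (a • s) = X.presheaf.germ U y hy a • gm M hy s :=
  PresheafOfModules.germ_smul (toPresheafOfModules M) y U hy a s

theorem exists_gm_eq (M : X.Modules) {y : X} (t : Stk M y) :
    ∃ (U : X.Opens) (hy : y ∈ U) (s : Sec M.val U), gm M hy s = t :=
  TopCat.Presheaf.exists_germ_eq M.presheaf t

theorem exists_rs_eq_of_gm_eq (M : X.Modules) {U W : X.Opens} {y : X} (hU : y ∈ U) (hW : y ∈ W)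
    (s : Sec M.val U) (t : Sec M.val W) (h : gm M hU s = gm M hW t) :
    ∃ (O : X.Opens) (hOU : O ≤ U) (hOW : O ≤ W), y ∈ O ∧ rs M.val hOU s = rs M.val hOW t := by
  obtain ⟨O, hy, i, j, hst⟩ := TopCat.Presheaf.germ_eq M.presheaf y hU hW s t h
  exact ⟨O, leOfHom i, leOfHom j, hy, hst⟩

theorem Gen.span_gm {M : X.Modules} {U : X.Opens} {ι : Type} {e : ι → Sec M.val U}
    (he : Gen M.val U e) {y : X} (hy : y ∈ U) :
    Submodule.span (X.presheaf.stalk y) (Set.range fun i => gm M hy (e i)) = ⊤ := by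
  refine eq_top_iff.mpr fun t _ => ?_
  obtain ⟨W, hW, s, rfl⟩ := exists_gm_eq M t
  obtain ⟨W', hU', hW', hy', hs⟩ := he W s y hy hW
  rw [← gm_rs M hy' hW']
  generalize rs M.val hW' s = t at hs
  induction hs using Submodule.span_induction with
  | mem x hx =>
    obtain ⟨i, rfl⟩ := hx
    exact Submodule.subset_span ⟨i, (gm_rs M hy' hU' (e i)).symm⟩
  | zero => rw [map_zero]; exact Submodule.zero_mem _
  | add x y _ _ hx hy => rw [map_add]; exact Submodule.add_mem _ hx hy
  | smul a x _ hx =>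
    rw [gm_smul]
    exact Submodule.smul_mem _ _ hx

/-- Nakayama's lemma: global sections span the fibre exactly when their germs span the finitely
generated stalk. -/
theorem notMem_baseLocus_iff {M : X.Modules} {x : X}
    [Module.Finite (X.presheaf.stalk x) (Stk M x)] :
    x ∉ baseLocus M ↔ Submodule.span (X.presheaf.stalk x) (Set.range (germ M x)) = ⊤ := by
  have h1 : Set.range (evalAt M x) =
      TensorProduct.mk (X.presheaf.stalk x) (ResField X x) (Stk M x) 1 '' Set.range (germ M x) := by
    rw [← Set.range_comp]; rfl
  rw [← IsLocalRing.map_tensorProduct_mk_eq_top (M := Stk M x), Submodule.map_span, ← h1,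
    ← Submodule.restrictScalars_span (X.presheaf.stalk x) (ResField X x)
    Ideal.Quotient.mk_surjective, Submodule.restrictScalars_eq_top_iff]
  exact not_not

section

variable [IsIntegral X] {V : Type} [AddCommGroup V] [Module (FF X) V]

theorem Rlz.exists_stk {M : X.Modules} (ρ : Rlz M.val V) (y : X) :
    ∃ φ : Stk M y →+ V, ∀ (U : X.Opens) (hy : y ∈ U) (s : Sec M.val U),
      φ (gm M hy s) = ρ.val U (generic_mem hy) s := by
  choose U hy s hs using exists_gm_eq M (y := y)
  have key : ∀ (t : Stk M y) (W : X.Opens) (hW : y ∈ W) (s' : Sec M.val W), gm M hW s' = t →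
      ρ.val (U t) (generic_mem (hy t)) (s t) = ρ.val W (generic_mem hW) s' := by
    intro t W hW s' h
    obtain ⟨O, hOU, hOW, hyO, hO⟩ := exists_rs_eq_of_gm_eq M (hy t) hW (s t) s'
      ((hs t).trans h.symm)
    rw [← ρ.val_rs hOU (generic_mem hyO), hO, ρ.val_rs]
  refine ⟨⟨⟨fun t => ρ.val (U t) (generic_mem (hy t)) (s t), ?_⟩, fun t t' => ?_⟩, fun W hW s' =>
    key _ W hW s' rfl⟩
  · exact (key 0 ⊤ trivial 0 (map_zero _)).trans (map_zero _)
  · refine (key (t + t') (U t ⊓ U t') ⟨hy t, hy t'⟩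
      (rs M.val inf_le_left (s t) + rs M.val inf_le_right (s t')) ?_).trans ?_
    · exact (map_add _ _ _).trans (congrArg₂ (· + ·)
      ((gm_rs M _ inf_le_left _).trans (hs t)) ((gm_rs M _ inf_le_right _).trans (hs t')))
    · rw [map_add, ρ.val_rs, ρ.val_rs]

/-- The stalk at `x` embeds in `V` with image the lattice at `x`, and by `exists_val_eq` the global
sections become exactly the vectors lying in every lattice. -/
theorem Rlz.span_germ_eq_top_iff {M : X.Modules} {ρ : Rlz M.val V} (hρ : ρ.IsGood) (x : X) :
    Submodule.span (X.presheaf.stalk x) (Set.range (germ M x)) = ⊤ ↔ IsGG ρ.lat x := by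
  obtain ⟨φ, hφ⟩ := ρ.exists_stk x
  have hsmul : ∀ (a : X.presheaf.stalk x) (t : Stk M x), φ (a • t) = stalkToFF x a • φ t := by
    intro a t
    obtain ⟨U, hU, b, rfl⟩ := X.presheaf.exists_germ_eq a
    obtain ⟨W, hW, s, rfl⟩ := exists_gm_eq M t
    have hx : x ∈ U ⊓ W := ⟨hU, hW⟩
    have h1 : X.presheaf.germ U x hU b = X.presheaf.germ (U ⊓ W) x hx (rf inf_le_left b) :=
      (X.presheaf.germ_res_apply (homOfLE inf_le_left) x hx b).symm
    rw [h1, ← gm_rs M hx inf_le_right, ← gm_smul, hφ, hφ, ρ.val_smul, stalkToFF_germ]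
  have hinj : Function.Injective φ := by
    rw [injective_iff_map_eq_zero]
    intro t ht
    obtain ⟨W, hW, s, rfl⟩ := exists_gm_eq M t
    rw [hφ] at ht
    rw [(map_eq_zero_iff _ (ρ.val_injective hρ _)).mp ht, map_zero]
  have hglob : φ '' Set.range (germ M x) = { v | ∀ y, v ∈ ρ.lat y } := by
    ext v
    constructor
    · rintro ⟨_, ⟨s, rfl⟩, rfl⟩ y
      exact ρ.mem_lat.mpr ⟨⊤, trivial, s, (hφ ⊤ trivial s).symm⟩
    · intro hv
      obtain ⟨s, rfl⟩ := ρ.exists_val_eq hρ (U := ⊤) trivial v fun y _ => hv y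
      exact ⟨_, ⟨s, rfl⟩, hφ ⊤ trivial s⟩
  rw [span_eq_top_iff_of_semilinear (stalkToFF x) φ hsmul hinj, hglob]
  constructor
  · intro h v hv
    obtain ⟨U, hU, s, rfl⟩ := ρ.mem_lat.mp hv
    exact (congrArg (· ∈ _) (hφ U hU s)).mp (h _)
  · intro h t
    obtain ⟨U, hU, s, rfl⟩ := exists_gm_eq M t
    exact (congrArg (· ∈ _) (hφ U hU s)).mpr (h (ρ.mem_lat.mpr ⟨U, hU, s, rfl⟩))

theorem Realizes.isGG_iff {M : X.Modules} {Λ : ∀ y : X, Submodule (loc y) V}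
    (h : Realizes M.val Λ) (x : X) : x ∉ baseLocus M ↔ IsGG Λ x := by
  obtain ⟨ρ, hρ, hΛ⟩ := h
  obtain rfl : ρ.lat = Λ := funext hΛ
  obtain ⟨U, hx, ι, hι, e, he, -⟩ := hρ x
  have : Module.Finite (X.presheaf.stalk x) (Stk M x) :=
    ⟨⟨(Set.finite_range fun i => gm M hx (e i)).toFinset, by
      rw [Set.Finite.coe_toFinset, he.span_gm hx]⟩⟩
  rw [notMem_baseLocus_iff, ρ.span_germ_eq_top_iff hρ]

theorem Realizes.isGG {M : X.Modules} {Λ : ∀ y : X, Submodule (loc y) V}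
    (h : Realizes M.val Λ) (hM : IsGloballyGenerated M) (x : X) : IsGG Λ x := by
  obtain ⟨ρ, hρ, hΛ⟩ := h
  obtain rfl : ρ.lat = Λ := funext hΛ
  exact (ρ.span_germ_eq_top_iff hρ x).mp (hM x)

/-- The lattice at `x` has finitely many generators that also generate nearby lattices. Writing each
through global elements uses finitely many coefficients of `loc x`, all regular on a common
neighbourhood. -/
theorem Realizes.isOpen_isGG {P : X.PresheafOfModules} {Λ : ∀ y : X, Submodule (loc y) V}
    (h : Realizes P Λ) : IsOpen {x | IsGG Λ x} := by
  obtain ⟨ρ, hρ, hΛ⟩ := h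
  obtain rfl : ρ.lat = Λ := funext hΛ
  rw [isOpen_iff_mem_nhds]
  intro x hx
  obtain ⟨U, hU, ι, hι, e, he, -⟩ := hρ x
  have key : ∀ v ∈ Submodule.span (loc x) { v | ∀ y, v ∈ ρ.lat y },
      ∀ᶠ z in nhds x, v ∈ Submodule.span (loc z) { v | ∀ y, v ∈ ρ.lat y } := by
    intro v hv
    induction hv using Submodule.span_induction with
    | mem v hv => exact Filter.Eventually.of_forall fun z => Submodule.subset_span hv
    | zero => exact Filter.Eventually.of_forall fun z => Submodule.zero_mem _
    | add v w _ _ hv hw => exact (hv.and hw).mono fun z hz => Submodule.add_mem _ hz.1 hz.2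
    | smul a v _ hv =>
      obtain ⟨W, hW, b, hb⟩ := mem_loc.mp a.2
      refine (hv.and (W.isOpen.mem_nhds hW)).mono fun z hz => ?_
      have : a • v = (⟨_, gK_mem_loc hz.2 b⟩ : loc z) • v :=
        congrArg (· • v) hb.symm
      rw [this]
      exact Submodule.smul_mem _ _ hz.1
  have hfin := Filter.eventually_all.mpr fun i =>
    key _ (hx (ρ.mem_lat.mpr ⟨U, hU, e i, rfl⟩))
  refine (hfin.and (U.isOpen.mem_nhds hU)).mono fun z hz => ?_
  change ρ.lat z ≤ _
  rw [ρ.lat_eq_span he hz.2, Submodule.span_le]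
  rintro _ ⟨i, rfl⟩
  exact hz.1 i

end

end VB

/-! ### Coherence of line bundles -/

namespace SheafOfModules

open Limits
universe u v₁ u₁
variable {C : Type u₁} [Category.{v₁} C] {J : GrothendieckTopology C} {R : Sheaf J RingCat.{u}}

theorem isIso_of_bijective {M N : SheafOfModules.{u} R} (f : M ⟶ N)
    (h : ∀ Y, Function.Bijective (f.val.app Y)) : IsIso f := by
  have : IsIso ((forget R).map f) := by
    have : IsIso ((PresheafOfModules.toPresheaf R.obj).map ((forget R).map f)) := by
      rw [NatTrans.isIso_iff_isIso_app]
      intro Y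
      rw [ConcreteCategory.isIso_iff_bijective]
      exact h Y
    exact isIso_of_reflects_iso _ (PresheafOfModules.toPresheaf R.obj)
  exact isIso_of_reflects_iso f (forget R)

variable [HasWeakSheafify J AddCommGrpCat.{u}] [J.WEqualsLocallyBijective AddCommGrpCat.{u}]

theorem isIso_freeHomEquiv_symm {M : SheafOfModules.{u} R} (s : PUnit.{u+1} → M.sections)
    (h : IsIso (M.unitHomEquiv.symm (s ⟨⟩))) : IsIso (M.freeHomEquiv.symm s) := by
  have h1 : ιFree (R := R) PUnit.unit ≫ M.freeHomEquiv.symm s = M.unitHomEquiv.symm (s ⟨⟩) := by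
    rw [← unitHomEquiv_symm_freeHomEquiv_apply, Equiv.apply_symm_apply]
  have h2 : IsIso (ιFree (R := R) PUnit.unit) :=
    ⟨Cofan.IsColimit.desc (isColimitFreeCofan PUnit) fun _ => 𝟙 _,
      Cofan.IsColimit.fac (isColimitFreeCofan PUnit) _ _,
      Cofan.IsColimit.hom_ext (isColimitFreeCofan PUnit) _ _ fun j =>
        (Cofan.IsColimit.fac_assoc (isColimitFreeCofan PUnit) _ j _).trans (by simp; rfl)⟩
  rw [← h1] at h
  exact IsIso.of_isIso_comp_left (ιFree (R := R) PUnit.unit) _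

end SheafOfModules

namespace VB

variable {X : Scheme.{0}}

/-- Ampleness is tested against coherent sheaves, and it will be applied to duals of line bundles
and to the structure sheaf. The local presentations have one generator and no relations. -/
theorem RealizesLine.isCoherent [IsIntegral X] {M : X.Modules} {c : X → (FF X)ˣ}
    (h : RealizesLine M.val c) : IsCoherent M := by
  obtain ⟨ρ, hρ⟩ := h
  have hgood := ρ.isGood_of_line hρ
  choose U hy e he hc using hρ
  let t : ∀ y, (M.over (U y)).sections := fun y =>
    PresheafOfModules.sectionsMk (fun Y => rs M.val (leOfHom Y.unop.hom) (e y)) (by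
      intro Y Z f
      exact rs_rs M.val (leOfHom Y.unop.hom) (leOfHom f.unop.left) (e y))
  have hiso : ∀ y, IsIso ((M.over (U y)).freeHomEquiv.symm fun _ : PUnit => t y) := by
    intro y
    refine SheafOfModules.isIso_freeHomEquiv_symm _
      (SheafOfModules.isIso_of_bijective _ fun Y => ?_)
    refine Rlz.bijective_smul hgood (he y) (generic_mem (hy y)) ?_ (leOfHom Y.unop.hom)
    rw [hc]
    exact (c y).ne_zero
  let q : SheafOfModules.LocalGeneratorsData.{0} (R := X.ringCatSheaf) M :=
    { I := X
      X := U
      coversTop := fun W z hz => ⟨W ⊓ U z, homOfLE inf_le_left,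
        (Sieve.mem_ofObjects_iff _ _).mpr ⟨z, ⟨homOfLE inf_le_right⟩⟩, hz, hy z⟩
      generators := fun y =>
        { I := PUnit
          s := fun _ => t y
          epi := inferInstance } }
  have : q.IsLocallyFreeData := ⟨hiso⟩
  refine ⟨q.quasiCoherentData, ⟨fun y => ⟨⟨?_⟩, ⟨?_⟩⟩⟩⟩
  · exact inferInstanceAs (Finite PUnit)
  · exact inferInstanceAs (Finite (ULift Empty))

/-! ### Membership in the asymptotic base loci -/

theorem notMem_stableBaseLocus {F : X.Modules} {x : X} :
    x ∉ stableBaseLocus F ↔ ∃ m, 0 < m ∧ x ∉ baseLocus (sym m F) := by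
  simp only [stableBaseLocus, Set.mem_iInter, not_forall, exists_prop]

theorem notMem_augmentedBaseLocus {A E : X.Modules} {x : X} :
    x ∉ augmentedBaseLocus A E ↔ ∃ p, 0 < p ∧ ∃ q, 0 < q ∧
      x ∉ stableBaseLocus (VB.tensor (VB.sym q E) (VB.tensorPow (VB.dual A) p)) := by
  simp only [augmentedBaseLocus, Set.mem_iInter, not_forall, exists_prop]

theorem notMem_restrictedBaseLocus {A E : X.Modules} {x : X} :
    x ∉ restrictedBaseLocus A E ↔ ∀ p, 0 < p → ∀ q, 0 < q →
      x ∉ stableBaseLocus (VB.tensor (VB.sym q E) (VB.tensorPow A p)) := by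
  simp only [restrictedBaseLocus, Set.mem_iUnion, not_exists]

theorem IsWeaklyPositive.isPseudoEffective {H E : X.Modules} (h : IsWeaklyPositive H E) :
    IsPseudoEffective H E := fun h' => h (by rw [h', closure_univ])

variable [IsIntegral X]

/-! ### Algebra of lattices: scaling, images and powers -/

section lattice

variable {V W : Type} [AddCommGroup V] [Module (FF X) V] [AddCommGroup W] [Module (FF X) W]
  {B C : Type} [CommRing B] [Algebra (FF X) B] [CommRing C] [Algebra (FF X) C] {y : X}

theorem scale_scale (c d : (FF X)ˣ) (Λ : Submodule (loc y) V) :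
    scale c (scale d Λ) = scale (c * d) Λ := by
  rw [scale, scale, scale, ← Submodule.map_comp]
  congr 1
  ext v
  exact smul_smul (c : FF X) (d : FF X) v

theorem push_scale (f : V →ₗ[FF X] W) (c : (FF X)ˣ) (Λ : Submodule (loc y) V) :
    push f (scale c Λ) = scale c (push f Λ) := by
  rw [scale, scale, push, push, ← Submodule.map_comp, ← Submodule.map_comp]
  congr 1
  ext v
  exact f.map_smul (c : FF X) v

theorem scale_one (Λ : Submodule (loc y) V) : scale 1 Λ = Λ := by
  refine Eq.trans ?_ (Submodule.map_id Λ)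
  rw [scale]
  congr 1
  ext v
  exact one_smul (FF X) v

theorem scale_mul_scale (c d : (FF X)ˣ) (Λ Λ' : Submodule (loc y) B) :
    scale c Λ * scale d Λ' = scale (c * d) (Λ * Λ') := by
  refine le_antisymm (Submodule.mul_le.mpr ?_) (Submodule.map_le_iff_le_comap.mpr
    (Submodule.mul_le.mpr ?_))
  · rintro _ ⟨a, ha, rfl⟩ _ ⟨b, hb, rfl⟩
    exact ⟨a * b, Submodule.mul_mem_mul ha hb, (smul_mul_smul_comm (c : FF X) a (d : FF X) b).symm⟩
  · intro a ha b hb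
    have := Submodule.mul_mem_mul (Submodule.mem_map_of_mem (f :=
      (LinearMap.lsmul (FF X) B (c : FF X)).restrictScalars (loc y)) ha)
      (Submodule.mem_map_of_mem (f :=
      (LinearMap.lsmul (FF X) B (d : FF X)).restrictScalars (loc y)) hb)
    exact (congrArg (· ∈ scale c Λ * scale d Λ')
      (smul_mul_smul_comm (c : FF X) a (d : FF X) b)).mp this

theorem scale_pow (c : (FF X)ˣ) (Λ : Submodule (loc y) B) (n : ℕ) :
    scale c Λ ^ n = scale (c ^ n) (Λ ^ n) := by
  induction n with
  | zero =>
    rw [pow_zero, pow_zero, scale_one]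
    exact pow_zero (scale c Λ)
  | succ n ih =>
    rw [pow_succ, pow_succ, ← scale_mul_scale, ← ih]
    exact pow_succ (scale c Λ) n

theorem push_pow (f : B →ₐ[FF X] C) (Λ : Submodule (loc y) B) (n : ℕ) :
    push f.toLinearMap (Λ ^ n) = push f.toLinearMap Λ ^ n :=
  Submodule.map_pow Λ (f.restrictScalars (loc y)) n

theorem push_symLift (Λ : Submodule (loc y) B) :
    push (symLift (LinearMap.id (R := FF X) (M := B))).toLinearMap
      (push (symι (FF X) B) Λ) = Λ := by
  rw [push, push, ← Submodule.map_comp]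
  refine Eq.trans ?_ (Submodule.map_id Λ)
  congr 1
  ext v
  exact symLift_ι _ v

/-- The identity of the algebra `B` extends to Sym B → B. For `Λ` a twisted power of the lattice of
E this is the multiplication Sym^n(Sym^q E ⊗ L) → Sym^{qn} E ⊗ L^n. -/
theorem push_symLift_pow (Λ : Submodule (loc y) B) (n : ℕ) :
    push (symLift (LinearMap.id (R := FF X) (M := B))).toLinearMap (push (symι (FF X) B) Λ ^ n) =
      Λ ^ n := by
  rw [push_pow, push_symLift]

end lattice

/-! ### Permanence of generation by global elements -/

section globalGeneration

variable {V W : Type} [AddCommGroup V] [Module (FF X) V] [AddCommGroup W] [Module (FF X) W]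
  {B : Type} [CommRing B] [Algebra (FF X) B] {x : X}

theorem IsGG.push {Λ : ∀ y : X, Submodule (loc y) V} (h : IsGG Λ x) (f : V →ₗ[FF X] W) :
    IsGG (fun y => push f (Λ y)) x := by
  refine (Submodule.map_mono h).trans ?_
  rw [Submodule.map_span]
  refine Submodule.span_mono ?_
  rintro _ ⟨v, hv, rfl⟩ y
  exact Submodule.mem_map_of_mem (hv y)

theorem IsGG.mul {Λ Λ' : ∀ y : X, Submodule (loc y) B} (h : IsGG Λ x) (h' : IsGG Λ' x) :
    IsGG (fun y => Λ y * Λ' y) x := by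
  refine (mul_le_mul' h h').trans ?_
  rw [Submodule.span_mul_span]
  refine Submodule.span_mono ?_
  rintro _ ⟨v, hv, w, hw, rfl⟩ y
  exact Submodule.mul_mem_mul (hv y) (hw y)

theorem IsGG.pow {Λ : ∀ y : X, Submodule (loc y) B} (h : IsGG Λ x) (n : ℕ) :
    IsGG (fun y => Λ y ^ n) x := by
  induction n with
  | zero =>
    simp only [pow_zero]
    exact (Submodule.one_eq_span (R := loc x) (A := B)).le.trans
      (Submodule.span_mono fun v hv y => (hv : v = 1) ▸ Submodule.one_le.mp le_rfl)
  | succ n ih =>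
    simp only [pow_succ]
    exact ih.mul h

/-- The fractional line bundle with local generators `d` is globally generated at `x`. -/
def LineGG (d : X → (FF X)ˣ) (x : X) : Prop :=
  IsGG (fun y => Submodule.span (loc y) {(d y : FF X)}) x

theorem LineGG.mul {d d' : X → (FF X)ˣ} (h : LineGG d x) (h' : LineGG d' x) :
    LineGG (d * d') x := by
  have := IsGG.mul h h'
  simp only [Submodule.span_mul_span, Set.singleton_mul_singleton] at this
  exact this

theorem LineGG.pow {d : X → (FF X)ˣ} (h : LineGG d x) (n : ℕ) : LineGG (d ^ n) x := by
  have := IsGG.pow h n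
  simp only [Submodule.span_pow, Set.singleton_pow] at this
  exact this

theorem IsGG.scale {Λ : ∀ y : X, Submodule (loc y) V} (h : IsGG Λ x) {d : X → (FF X)ˣ}
    (hd : LineGG d x) : IsGG (fun y => VB.scale (d y) (Λ y)) x := by
  rintro _ ⟨v, hv, rfl⟩
  have key : ∀ c ∈ Submodule.span (loc x)
      { c : FF X | ∀ y, c ∈ Submodule.span (loc y) {(d y : FF X)} },
      ∀ w ∈ Submodule.span (loc x) { v | ∀ y, v ∈ Λ y },
      c • w ∈ Submodule.span (loc x) { v | ∀ y, v ∈ VB.scale (d y) (Λ y) } := by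
    intro c hc w hw
    induction hc using Submodule.span_induction with
    | zero => rw [zero_smul]; exact Submodule.zero_mem _
    | add a b _ _ ha hb => rw [add_smul]; exact Submodule.add_mem _ ha hb
    | smul a b _ hb => rw [smul_assoc]; exact Submodule.smul_mem _ a hb
    | mem c hc =>
      induction hw using Submodule.span_induction with
      | zero => rw [smul_zero]; exact Submodule.zero_mem _
      | add a b _ _ ha hb => rw [smul_add]; exact Submodule.add_mem _ ha hb
      | smul a b _ hb => rw [smul_comm]; exact Submodule.smul_mem _ a hb
      | mem w hw =>
        refine Submodule.subset_span fun y => ?_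
        obtain ⟨a, ha⟩ := Submodule.mem_span_singleton.mp (hc y)
        refine ⟨a • w, Submodule.smul_mem _ a (hw y), ?_⟩
        rw [← ha, smul_assoc]
        exact smul_comm (d y : FF X) a w
  exact key _ (hd (Submodule.mem_span_singleton_self _)) v (h hv)

end globalGeneration

/-! ### Ampleness and the two main implications -/

section sheaves

variable {V : Type} [AddCommGroup V] [Module (FF X) V] {B : Type} [CommRing B] [Algebra (FF X) B]

theorem Realizes.tensor {M N : X.Modules} {Λ : ∀ y : X, Submodule (loc y) V} {c : X → (FF X)ˣ}
    (h : Realizes M.val Λ) (h' : RealizesLine N.val c) :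
    Realizes (tensor M N).val fun y => scale (c y) (Λ y) :=
  (h.tensorPre h').sheafify

theorem Realizes.sym {M : X.Modules} {Λ : ∀ y : X, Submodule (loc y) V}
    (h : Realizes M.val Λ) (n : ℕ) :
    Realizes (sym n M).val fun y => push (symι (FF X) V) (Λ y) ^ n :=
  (h.symPre n).sheafify

theorem RealizesLine.tensor {M N : X.Modules} {c c' : X → (FF X)ˣ}
    (h : RealizesLine M.val c) (h' : RealizesLine N.val c') :
    RealizesLine (tensor M N).val (c * c') :=
  (RealizesLine.tensorPre h h').sheafify

theorem RealizesLine.dual {M : X.Modules} {c : X → (FF X)ˣ} (h : RealizesLine M.val c) :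
    RealizesLine (dual M).val c⁻¹ :=
  h.dualPre.sheafify

theorem RealizesLine.tensorPow {M : X.Modules} {c : X → (FF X)ˣ} (h : RealizesLine M.val c)
    (n : ℕ) : RealizesLine (tensorPow M n).val (c ^ n) := by
  induction n with
  | zero => rw [pow_zero]; exact realizesLine_unit
  | succ n ih => rw [pow_succ]; exact ih.tensor h

theorem IsAmple.exists_lineGG {H F : X.Modules} (hH : IsAmple H) {c d : X → (FF X)ˣ}
    (hc : RealizesLine H.val c) (hd : RealizesLine F.val d) :
    ∃ n₀ : ℕ, ∀ n, n₀ ≤ n → ∀ x, LineGG (d * c ^ n) x := by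
  obtain ⟨n₀, hn₀⟩ := hH.2 F hd.isCoherent
  exact ⟨n₀, fun n hn x => (hd.tensor (hc.tensorPow n)).realizes.isGG (hn₀ n hn) x⟩

theorem IsAmple.exists_lineGG_pow {H : X.Modules} (hH : IsAmple H) {c : X → (FF X)ˣ}
    (hc : RealizesLine H.val c) : ∃ n₀ : ℕ, ∀ n, n₀ ≤ n → ∀ x, LineGG (c ^ n) x := by
  obtain ⟨n₀, h⟩ := hH.exists_lineGG hc realizesLine_unit
  exact ⟨n₀, fun n hn x => by simpa only [one_mul] using h n hn x⟩

/-- Outside a stable base locus, the powers of a twisted symmetric power are generated. -/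
theorem exists_isGG_of_notMem_stableBaseLocus {E L : X.Modules} {Λ : ∀ y : X, Submodule (loc y) V}
    (hE : Realizes E.val Λ) {d : X → (FF X)ˣ} (hL : RealizesLine L.val d) {q : ℕ} {x : X}
    (hx : x ∉ stableBaseLocus (VB.tensor (VB.sym q E) L)) :
    ∃ m, 0 < m ∧ IsGG (fun y => scale (d y ^ m) (push (symι (FF X) V) (Λ y) ^ (q * m))) x := by
  obtain ⟨m, hm, hx⟩ := notMem_stableBaseLocus.mp hx
  refine ⟨m, hm, ?_⟩
  have h := ((((hE.sym q).tensor hL).sym m).isGG_iff x).mp hx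
  have h' := h.push (symLift (LinearMap.id (R := FF X) (M := SV (FF X) V))).toLinearMap
  simpa only [push_symLift_pow, scale_pow, ← pow_mul] using h'

theorem notMem_stableBaseLocus_of_isGG {E L : X.Modules} {Λ : ∀ y : X, Submodule (loc y) V}
    (hE : Realizes E.val Λ) {d : X → (FF X)ˣ} (hL : RealizesLine L.val d) {q : ℕ} {x : X}
    (h : IsGG (fun y => scale (d y) (push (symι (FF X) V) (Λ y) ^ q)) x) :
    x ∉ stableBaseLocus (VB.tensor (VB.sym q E) L) :=
  notMem_stableBaseLocus.mpr ⟨1, one_pos,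
    ((((hE.sym q).tensor hL).sym 1).isGG_iff x).mpr ((h.push _).pow 1)⟩

/-- The lattice of Sym^m(Sym^q E ⊗ L) is that of Sym^m(Sym^q E) scaled by d^m, so only the power L^m
has to be generated at `x`, not L itself. -/
theorem notMem_stableBaseLocus_of_lineGG {E L : X.Modules} {Λ : ∀ y : X, Submodule (loc y) V}
    (hE : Realizes E.val Λ) {d : X → (FF X)ˣ} (hL : RealizesLine L.val d) {q : ℕ} {x : X}
    (h : IsGG Λ x) {m : ℕ} (hm : 0 < m) (hd : LineGG (d ^ m) x) :
    x ∉ stableBaseLocus (VB.tensor (VB.sym q E) L) := by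
  refine notMem_stableBaseLocus.mpr ⟨m, hm, ((((hE.sym q).tensor hL).sym m).isGG_iff x).mpr ?_⟩
  simp only [push_scale, scale_pow]
  exact ((((h.push _).pow q).push _).pow m).scale hd

/-- If a twist of a symmetric power by a negative ample line bundle is pseudo-effective, then the
augmented base locus is not everything. -/
theorem augmentedBaseLocus_ne_univ_of_isPseudoEffective {r : ℕ} {E A H H' : X.Modules}
    (hE : IsLocallyFreeOfRank E r) (hA : IsAmple A) (hH : IsLineBundle H) (hH' : IsLineBundle H')
    {c : ℕ} (hc : 0 < c) (h : IsPseudoEffective H (VB.tensor (VB.sym c E) (VB.dual A))) :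
    augmentedBaseLocus H' E ≠ Set.univ := by
  obtain ⟨Λ, hΛ⟩ := exists_realizes hE
  obtain ⟨a, ha⟩ := exists_realizesLine hA.1
  obtain ⟨b, hb⟩ := exists_realizesLine hH
  obtain ⟨b', hb'⟩ := exists_realizesLine hH'
  -- A^n ⊗ H^{-1} will cancel the twist by H allowed in 𝔹₋, and A^{n'+1} ⊗ H'^{-1} will produce the
  -- negative twist by H'.
  obtain ⟨n, hn⟩ := hA.exists_lineGG ha hb.dual
  obtain ⟨n', hn'⟩ := hA.exists_lineGG ha hb'.dual
  obtain ⟨x, hx⟩ := (Set.ne_univ_iff_exists_notMem _).mp h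
  refine (Set.ne_univ_iff_exists_notMem _).mpr ⟨x, ?_⟩
  -- The symmetric power is N = n + (n' + 1), the total number of copies of A to be multiplied back
  -- in; the extra 1 makes N positive.
  obtain ⟨k, hk, hgg⟩ := exists_isGG_of_notMem_stableBaseLocus ((hΛ.sym c).tensor ha.dual)
    (hb.tensorPow 1) (notMem_restrictedBaseLocus.mp hx 1 one_pos (n + (n' + 1)) (Nat.succ_pos _))
  have hline := ((hn n le_rfl x).mul (hn' (n' + 1) n'.le_succ x)).pow k
  have h1 := (hgg.push (symLift (LinearMap.id (R := FF X)
    (M := SV (FF X) (Fin r → FF X)))).toLinearMap).scale hline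
  refine notMem_augmentedBaseLocus.mpr ⟨k, hk, c * ((n + (n' + 1)) * k), by positivity,
    notMem_stableBaseLocus_of_isGG hΛ (hb'.dual.tensorPow k) ?_⟩
  simp only [push_scale, push_symLift_pow, scale_pow, scale_scale, ← pow_mul] at h1
  -- The powers of A and of H cancel, leaving H'^{-k}.
  have hexp : ∀ y, ((b⁻¹ * a ^ n * (b'⁻¹ * a ^ (n' + 1))) ^ k) y *
      ((b ^ 1) y ^ k * a⁻¹ y ^ ((n + (n' + 1)) * k)) = (b'⁻¹ ^ k) y := by
    intro y
    simp only [Pi.pow_apply, Pi.mul_apply, Pi.inv_apply, pow_one]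
    rw [pow_mul, ← mul_pow, ← mul_pow]
    congr 1
    rw [inv_pow, pow_add (a y) n (n' + 1), mul_mul_mul_comm (b y)⁻¹, mul_mul_mul_comm,
      mul_inv_cancel, mul_one, mul_right_comm, inv_mul_cancel, one_mul]
  simp only [hexp] at h1
  exact h1

/-- If the augmented base locus is not everything, then some symmetric power twisted by a negative
ample line bundle is generated by global sections over a nonempty open set, and weakly positive. -/
theorem exists_isWeaklyPositive_of_augmentedBaseLocus_ne_univ {r : ℕ} {E H : X.Modules}
    (hE : IsLocallyFreeOfRank E r) (hH : IsAmple H) (h : augmentedBaseLocus H E ≠ Set.univ) :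
    ∃ c, 0 < c ∧ ∀ H' : X.Modules, IsAmple H' →
      IsWeaklyPositive H' (VB.tensor (VB.sym c E) (VB.dual H)) := by
  obtain ⟨Λ, hΛ⟩ := exists_realizes hE
  obtain ⟨a, ha⟩ := exists_realizesLine hH.1
  obtain ⟨n, hn⟩ := hH.exists_lineGG_pow ha
  obtain ⟨x, hx⟩ := (Set.ne_univ_iff_exists_notMem _).mp h
  obtain ⟨p, hp, q, hq, hx⟩ := notMem_augmentedBaseLocus.mp hx
  obtain ⟨m, hm, hgg⟩ := exists_isGG_of_notMem_stableBaseLocus hΛ (ha.dual.tensorPow p) hx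
  -- The (n+1)-st power of Sym^{qm} E ⊗ H^{-pm} carries H^{-pm(n+1)}. All but one of these factors
  -- are cancelled by H^{pm(n+1)-1}, which is generated because pm(n+1) - 1 ≥ n.
  refine ⟨q * m * (n + 1), by positivity, fun H' hH' => ?_⟩
  have hF := (hΛ.sym (q * m * (n + 1))).tensor ha.dual
  have hline : LineGG (a ^ (p * m * (n + 1) - 1)) x := by
    refine hn _ ?_ x
    have : 1 * (n + 1) ≤ p * m * (n + 1) := Nat.mul_le_mul_right _ (Nat.mul_pos hp hm)
    omega
  have hxF := (hgg.pow (n + 1)).scale hline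
  simp only [scale_pow, scale_scale, ← pow_mul] at hxF
  have hexp : ∀ y, (a ^ (p * m * (n + 1) - 1)) y * (a⁻¹ ^ p) y ^ (m * (n + 1)) = a⁻¹ y := by
    intro y
    have : p * m * (n + 1) = (p * m * (n + 1) - 1) + 1 :=
      (Nat.sub_add_cancel (Nat.mul_pos (Nat.mul_pos hp hm) n.succ_pos)).symm
    rw [Pi.pow_apply, Pi.pow_apply, Pi.inv_apply, ← pow_mul, ← mul_assoc]
    conv_lhs => rw [this, Nat.add_sub_cancel, pow_succ, inv_pow, mul_inv_cancel_left]
  simp only [hexp] at hxF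
  obtain ⟨b, hb⟩ := exists_realizesLine hH'.1
  obtain ⟨n', hn'⟩ := hH'.exists_lineGG_pow hb
  refine fun htop => ?_
  -- The points where F is not generated form a closed set missing `x`; it remains to see that it
  -- contains 𝔹₋(F).
  refine closure_minimal (fun y hy hyF => ?_) hF.isOpen_isGG.isClosed_compl
    (htop.ge (Set.mem_univ x)) hxF
  · refine notMem_restrictedBaseLocus.mpr (fun p hp q hq => ?_) hy
    -- With m = n' + 1 the twist becomes H'^{p(n'+1)}, whose exponent is at least n' for every p >
    -- 0.
    refine notMem_stableBaseLocus_of_lineGG hF (hb.tensorPow p) hyF n'.succ_pos ?_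
    rw [← pow_mul]
    exact hn' _ (le_trans n'.le_succ (Nat.le_mul_of_pos_left _ hp)) y

end sheaves

end VB

end

theorem mainTheorem3 (X : Scheme.{0}) (f : X ⟶ Spec (.of ℂ))
    (hint : IsIntegral X) (hsm : Smooth f) (hproj : VB.IsProjective f)
    (E : X.Modules) (hE : VB.IsVectorBundle E)
    (H₁ H₂ H₃ : X.Modules)
    (hH₁ : VB.IsAmple H₁) (hH₂ : VB.IsAmple H₂) (hH₃ : VB.IsAmple H₃) :
    List.TFAE [
      VB.IsVBig H₁ E,
      ∃ A : X.Modules, VB.IsAmple A ∧ ∃ c : ℕ, 0 < c ∧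
        VB.IsPseudoEffective H₂ (VB.tensor (VB.sym c E) (VB.dual A)),
      VB.augmentedBaseLocus H₃ E ≠ Set.univ] := by
  obtain ⟨r, hr⟩ := hE
  tfae_have 1 → 3 := by
    rintro ⟨A, hA, c, hc, h⟩
    exact VB.augmentedBaseLocus_ne_univ_of_isPseudoEffective hr hA hH₁.1 hH₃.1 hc
      h.isPseudoEffective
  tfae_have 2 → 3 := by
    rintro ⟨A, hA, c, hc, h⟩
    exact VB.augmentedBaseLocus_ne_univ_of_isPseudoEffective hr hA hH₂.1 hH₃.1 hc h
  tfae_have 3 → 1 := by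
    intro h
    obtain ⟨c, hc, hw⟩ := VB.exists_isWeaklyPositive_of_augmentedBaseLocus_ne_univ hr hH₃ h
    exact ⟨H₃, hH₃, c, hc, hw H₁ hH₁⟩
  tfae_have 3 → 2 := by
    intro h
    obtain ⟨c, hc, hw⟩ := VB.exists_isWeaklyPositive_of_augmentedBaseLocus_ne_univ hr hH₃ h
    exact ⟨H₃, hH₃, c, hc, (hw H₂ hH₂).isPseudoEffective⟩
  tfae_finish
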